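/- **Craig interpolation for LJ.** Consider first-order formulas without equality over an arbitrary language of predicate symbols and function symbols (constants included), built with $\neg,\wedge,\vee,\forall,\exists$ from atomic formulas and the predicate constants $\top,\bot$. A sequent is $\Gamma\rightarrow\Delta$ with $\Gamma,\Delta$ finite, possibly empty, multisets of formulas. The (cut-free) calculus LJ has the axioms $\Gamma, C\rightarrow C$ and the following rules, in which $C^1,\dots,C^k$ denotes $k$ occurrences of one formula $C$, $k,l\ge 0$, $s\ge 2$, and $t$ is any term: - $\neg$: from $\Gamma\rightarrow A$ infer $\neg A,\Gamma\rightarrow$; from $A,\Gamma\rightarrow$ infer $\Gamma\rightarrow\neg A$. - $\wedge$: from $\Gamma_1\rightarrow A$ and $\Gamma_2\rightarrow B$ infer $\Gamma_1,\Gamma_2\rightarrow A\wedge B$; from $A,\Gamma\rightarrow C^1,\dots,C^k$ infer $A\wedge B,\Gamma\rightarrow C^1,\dots,C^k$ and infer $B\wedge A,\Gamma\rightarrow C^1,\dots,C^k$. - $\vee$: from $A,\Gamma_1\rightarrow C^1,\dots,C^k$ and $B,\Gamma_2\rightarrow C^1,\dots,C^l$ infer $A\vee B,\Gamma_1,\Gamma_2\rightarrow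 C^1,\dots,C^{k+l}$; from $\Gamma\rightarrow A$ infer $\Gamma\rightarrow A\vee B$ and infer $\Gamma\rightarrow B\vee A$. - $\forall$: from $\Gamma\rightarrow A(a)$ infer $\Gamma\rightarrow\forall x.A(x)$; from $A(t),\Gamma\rightarrow C^1,\dots,C^k$ infer $\forall x.A(x),\Gamma\rightarrow C^1,\dots,C^k$. - $\exists$: from $\Gamma\rightarrow A(t)$ infer $\Gamma\rightarrow\exists x.A(x)$; from $A(a),\Gamma\rightarrow C^1,\dots,C^k$ infer $\exists x.A(x),\Gamma\rightarrow C^1,\dots,C^k$. - Contraction: from $\Gamma\rightarrow C^1,\dots,C^s$ infer $\Gamma\rightarrow C^1,\dots,C^{s-1}$; from $A,A,\Gamma\rightarrow C^1,\dots,C^k$ infer $A,\Gamma\rightarrow C^1,\dots,C^k$. In the rules with eigenvariable $a$ (introduction of $\forall$ on the right, of $\exists$ on the left), $a$ is not free in $\Gamma$, in $C$ or in the quantified formula. One may work either with the axioms $\Gamma,C\rightarrow C$ alone (then $\top,\bot$ are ordinary $0$-ary predicates), or with the additional axioms $\Gamma\rightarrow\top$ and $\bot,\Gamma\rightarrow$;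 below, "provable" refers to one of these two versions, fixed throughout. Let $A$ and $B$ be formulas such that $A\rightarrow B$ is provable. 1. If $A$ and $B$ have a predicate symbol in common ($\top$ and $\bot$ being counted as predicate symbols), then there is a formula $I$ such that every predicate symbol, every function symbol or constant, and every free variable of $I$ occurs both in $A$ and in $B$, and such that $A\rightarrow I$ and $I\rightarrow B$ are provable. 2. If $A$ and $B$ have no predicate symbol in common, then $A\rightarrow$ is provable or $\rightarrow B$ is provable. 3. In the version with the axioms for $\top$ and $\bot$, there is in all cases a formula $I$ such that $A\rightarrow I$ and $I\rightarrow B$ are provable, every predicate symbol of $I$ other than $\top,\bot$ occurs both in $A$ and in $B$, and so does every function symbol or constant and every free variable of $I$. -/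

import Mathlib

universe u v

namespace LJ

/-- First-order formulas over the language `L`, without equality. The free variables are the natural
numbers; `Formula L n` may in addition use `n` bound-variable slots, and a quantifier binds the last
slot of its body. The formulas proper are the elements of `Formula L 0`. -/
inductive Formula (L : FirstOrder.Language.{u, v}) : ℕ → Type (max u v) where
  | top {n : ℕ} : Formula L n
  | bot {n : ℕ} : Formula L n
  | rel {n l : ℕ} (R : L.Relations l) (ts : Fin l → L.Term (ℕ ⊕ Fin n)) : Formula L n
  | neg {n : ℕ} (A : Formula L n) : Formula L n
  | and {n : ℕ} (A B : Formula L n) : Formula L n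
  | or {n : ℕ} (A B : Formula L n) : Formula L n
  | all {n : ℕ} (A : Formula L (n + 1)) : Formula L n
  | ex {n : ℕ} (A : Formula L (n + 1)) : Formula L n

/-- Predicate symbols: the relation symbols of `L` and the predicate constants `⊤`, `⊥`. -/
inductive PredSymbol (L : FirstOrder.Language.{u, v}) : Type v where
  | top : PredSymbol L
  | bot : PredSymbol L
  | rel {l : ℕ} (R : L.Relations l) : PredSymbol L

/-- The function symbols (constants included) occurring in a term. -/
def termFuncs {L : FirstOrder.Language.{u, v}} {α : Type} :
    L.Term α → Set (Σ l : ℕ, L.Functions l)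
  | .var _ => ∅
  | .func (l := l) f ts => insert ⟨l, f⟩ (⋃ i, termFuncs (ts i))

namespace Formula

variable {L : FirstOrder.Language.{u, v}}

/-- The predicate symbols occurring in a formula. -/
def preds : {n : ℕ} → Formula L n → Set (PredSymbol L)
  | _, top => {PredSymbol.top}
  | _, bot => {PredSymbol.bot}
  | _, rel R _ => {PredSymbol.rel R}
  | _, neg A => A.preds
  | _, and A B => A.preds ∪ B.preds
  | _, or A B => A.preds ∪ B.preds
  | _, all A => A.preds
  | _, ex A => A.preds

/-- The function symbols (constants included) occurring in a formula. -/
def funcs : {n : ℕ} → Formula L n → Set (Σ l : ℕ, L.Functions l)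
  | _, top => ∅
  | _, bot => ∅
  | _, rel _ ts => ⋃ i, termFuncs (ts i)
  | _, neg A => A.funcs
  | _, and A B => A.funcs ∪ B.funcs
  | _, or A B => A.funcs ∪ B.funcs
  | _, all A => A.funcs
  | _, ex A => A.funcs

/-- The free variables occurring in a formula. -/
def freeVars : {n : ℕ} → Formula L n → Set ℕ
  | _, top => ∅
  | _, bot => ∅
  | _, rel _ ts => ⋃ i, {x | x ∈ (ts i).varFinsetLeft}
  | _, neg A => A.freeVars
  | _, and A B => A.freeVars ∪ B.freeVars
  | _, or A B => A.freeVars ∪ B.freeVars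
  | _, all A => A.freeVars
  | _, ex A => A.freeVars

/-- A substitution pushed under a quantifier: the new last slot is left alone. -/
def liftSubst {n m : ℕ} (σ : ℕ ⊕ Fin n → L.Term (ℕ ⊕ Fin m)) :
    ℕ ⊕ Fin (n + 1) → L.Term (ℕ ⊕ Fin (m + 1)) :=
  Sum.elim
    (fun x => (σ (Sum.inl x)).relabel (Sum.map id Fin.castSucc))
    (Fin.lastCases (.var (Sum.inr (Fin.last m)))
      (fun i => (σ (Sum.inr i)).relabel (Sum.map id Fin.castSucc)))

/-- Simultaneous capture-free substitution of terms for free variables and bound slots. -/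
def subst : {n m : ℕ} → Formula L n → (ℕ ⊕ Fin n → L.Term (ℕ ⊕ Fin m)) → Formula L m
  | _, _, top, _ => top
  | _, _, bot, _ => bot
  | _, _, rel R ts, σ => rel R (fun i => (ts i).subst σ)
  | _, _, neg A, σ => neg (A.subst σ)
  | _, _, and A B, σ => and (A.subst σ) (B.subst σ)
  | _, _, or A B, σ => or (A.subst σ) (B.subst σ)
  | _, _, all A, σ => all (A.subst (liftSubst σ))
  | _, _, ex A, σ => ex (A.subst (liftSubst σ))

/-- For `A = A(x)` with one open slot `x` and a term `t`, the formula `A(t)`. -/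
def inst (A : Formula L 1) (t : L.Term ℕ) : Formula L 0 :=
  A.subst (Sum.elim (fun x => .var (Sum.inl x)) (fun _ => t.relabel Sum.inl))

end Formula

open Formula in
/-- Provability of the sequent `Γ → Δ` in the (cut-free) intuitionistic calculus LJ, where cedents
are multisets. `Multiset.replicate k C` is the succedent `C¹, …, Cᵏ` of `k` occurrences of `C`.
If `c = false` the only axioms are `Γ, C → C` (and `⊤`, `⊥` have no special role); if `c = true` the
axioms `Γ → ⊤` and `⊥, Γ →` are present as well. -/
inductive Provable {L : FirstOrder.Language.{u, v}} (c : Bool) :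
    Multiset (Formula L 0) → Multiset (Formula L 0) → Prop where
  | ax (Γ : Multiset (Formula L 0)) (C : Formula L 0) : Provable c (C ::ₘ Γ) {C}
  | topAx (hc : c = true) (Γ : Multiset (Formula L 0)) : Provable c Γ {top}
  | botAx (hc : c = true) (Γ : Multiset (Formula L 0)) : Provable c (bot ::ₘ Γ) 0
  | negLeft {Γ : Multiset (Formula L 0)} {A : Formula L 0} :
      Provable c Γ {A} → Provable c (neg A ::ₘ Γ) 0
  | negRight {Γ : Multiset (Formula L 0)} {A : Formula L 0} :
      Provable c (A ::ₘ Γ) 0 → Provable c Γ {neg A}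
  | andRight {Γ₁ Γ₂ : Multiset (Formula L 0)} {A B : Formula L 0} :
      Provable c Γ₁ {A} → Provable c Γ₂ {B} → Provable c (Γ₁ + Γ₂) {and A B}
  | andLeft₁ {Γ : Multiset (Formula L 0)} {A B C : Formula L 0} {k : ℕ} :
      Provable c (A ::ₘ Γ) (Multiset.replicate k C) →
      Provable c (and A B ::ₘ Γ) (Multiset.replicate k C)
  | andLeft₂ {Γ : Multiset (Formula L 0)} {A B C : Formula L 0} {k : ℕ} :
      Provable c (A ::ₘ Γ) (Multiset.replicate k C) →
      Provable c (and B A ::ₘ Γ) (Multiset.replicate k C)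
  | orLeft {Γ₁ Γ₂ : Multiset (Formula L 0)} {A B C : Formula L 0} {k l : ℕ} :
      Provable c (A ::ₘ Γ₁) (Multiset.replicate k C) →
      Provable c (B ::ₘ Γ₂) (Multiset.replicate l C) →
      Provable c (or A B ::ₘ (Γ₁ + Γ₂)) (Multiset.replicate (k + l) C)
  | orRight₁ {Γ : Multiset (Formula L 0)} {A B : Formula L 0} :
      Provable c Γ {A} → Provable c Γ {or A B}
  | orRight₂ {Γ : Multiset (Formula L 0)} {A B : Formula L 0} :
      Provable c Γ {A} → Provable c Γ {or B A}
  | allRight {Γ : Multiset (Formula L 0)} {A : Formula L 1} (a : ℕ)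
      (hΓ : ∀ G ∈ Γ, a ∉ G.freeVars) (hA : a ∉ A.freeVars) :
      Provable c Γ {A.inst (.var a)} → Provable c Γ {all A}
  | allLeft {Γ : Multiset (Formula L 0)} {A : Formula L 1} {C : Formula L 0} {k : ℕ}
      (t : L.Term ℕ) :
      Provable c (A.inst t ::ₘ Γ) (Multiset.replicate k C) →
      Provable c (all A ::ₘ Γ) (Multiset.replicate k C)
  | exRight {Γ : Multiset (Formula L 0)} {A : Formula L 1} (t : L.Term ℕ) :
      Provable c Γ {A.inst t} → Provable c Γ {ex A}
  | exLeft {Γ : Multiset (Formula L 0)} {A : Formula L 1} {C : Formula L 0} {k : ℕ} (a : ℕ)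
      (hΓ : ∀ G ∈ Γ, a ∉ G.freeVars) (hA : a ∉ A.freeVars) (hC : a ∉ C.freeVars) :
      Provable c (A.inst (.var a) ::ₘ Γ) (Multiset.replicate k C) →
      Provable c (ex A ::ₘ Γ) (Multiset.replicate k C)
  | contrRight {Γ : Multiset (Formula L 0)} {C : Formula L 0} {s : ℕ} (hs : 2 ≤ s) :
      Provable c Γ (Multiset.replicate s C) →
      Provable c Γ (Multiset.replicate (s - 1) C)
  | contrLeft {Γ : Multiset (Formula L 0)} {A C : Formula L 0} {k : ℕ} :
      Provable c (A ::ₘ A ::ₘ Γ) (Multiset.replicate k C) →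
      Provable c (A ::ₘ Γ) (Multiset.replicate k C)

end LJ

/-! Maehara's method. By induction on a cut-free derivation whose antecedent is split as `Γ₁, Γ₂`,
one finds `I` with `Γ₁ → I` and `I, Γ₂ → Δ` provable and with predicate symbols common to both sides
(`Provable.exists_isInterpolant`). A formula `T` provable from any antecedent serves where the two
sides do not interact; it is `¬(R ∧ ¬R)` with a common predicate symbol, or `⊤` in the version with
its axioms.

Quantifier rules may bring terms with arbitrary function symbols into `I`. Relative to a set `F` of
function symbols, a maximal subterm headed by a foreign symbol behaves like a free variable,
provided that it contains no bound variable: such atoms can be replaced throughout a derivation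
(`Provable.gsub`). The induction keeps formulas admissible in this sense, and the unwanted atoms of
`I` are then quantified away, largest first. An atom missing from `Γ₁` is bound by `∀`, one missing
from `Γ₂` and `Δ` by `∃` (`IsInterpolant.exists_remove`). The same device removes eigenvariables
during the induction. What remains has only common free variables as atoms, hence only common
function symbols.

Without a common predicate symbol there is no candidate for `T`, and a second induction is run
(`Provable.separates`). The calculus has no weakening on the right, so a refutable `Γ₁` does not
give `Γ₁, Γ₂ → Δ` for nothing. Still, if `Γ₁` is used in the derivation, it is used only through its
refutability. The invariant says so: either `Γ₂ → Δ` is provable alone, or `Γ₁` is refutable and any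
refutable `Θ` can take its place. For the same lack of weakening, multiplicities in the succedent
are ignored there. -/

namespace LJ

open FirstOrder.Language

variable {L : FirstOrder.Language.{u, v}}

/-! ### Terms relative to a set of function symbols

Fix a set `F` of function symbols. The `F`-atoms of a term are its free variables outside of
subterms headed by symbols not in `F`, and the maximal subterms of the latter kind. -/

/-- Forgets the bound slots of a term; meaningful for terms without slots. -/
def toFree {n : ℕ} (t : L.Term (ℕ ⊕ Fin n)) : L.Term ℕ :=
  t.relabel (Sum.elim id fun _ => 0)

@[simp]
theorem toFree_relabel_inl {n : ℕ} (s : L.Term ℕ) :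
    toFree (s.relabel Sum.inl : L.Term (ℕ ⊕ Fin n)) = s := by
  simp only [toFree, Term.relabel_relabel]
  exact Term.relabel_id s

theorem relabel_inl_toFree (t : L.Term (ℕ ⊕ Fin 0)) : (toFree t).relabel Sum.inl = t := by
  rw [toFree, Term.relabel_relabel]
  convert Term.relabel_id t
  funext x
  rcases x with x | i
  · rfl
  · exact i.elim0

@[simp]
theorem toFree_relabel_castSucc {n : ℕ} (t : L.Term (ℕ ⊕ Fin n)) :
    toFree (t.relabel (Sum.map id Fin.castSucc) : L.Term (ℕ ⊕ Fin (n + 1))) = toFree t := by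
  simp only [toFree, Term.relabel_relabel]
  congr 1
  funext x
  rcases x with x | i <;> rfl

/-- No subterm headed by a function symbol outside `F` contains a bound slot. -/
inductive TermAdm (F : Set (Σ l : ℕ, L.Functions l)) {n : ℕ} : L.Term (ℕ ⊕ Fin n) → Prop
  | var (x : ℕ ⊕ Fin n) : TermAdm F (.var x)
  | func {l : ℕ} (f : L.Functions l) (ts : Fin l → L.Term (ℕ ⊕ Fin n)) :
      ⟨l, f⟩ ∈ F → (∀ i, TermAdm F (ts i)) → TermAdm F (.func f ts)
  | free {l : ℕ} (f : L.Functions l) (ts : Fin l → L.Term ℕ) :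
      ⟨l, f⟩ ∉ F → TermAdm F (.func f fun i => (ts i).relabel Sum.inl)

theorem TermAdm.relabel_inl (F : Set (Σ l : ℕ, L.Functions l)) {n : ℕ} (s : L.Term ℕ) :
    TermAdm F (s.relabel Sum.inl : L.Term (ℕ ⊕ Fin n)) := by
  induction s with
  | var x => exact .var _
  | @func l f ts ih =>
    by_cases hf : (⟨l, f⟩ : Σ l : ℕ, L.Functions l) ∈ F
    · exact .func f _ hf ih
    · exact .free f ts hf

theorem TermAdm.mono {F F' : Set (Σ l : ℕ, L.Functions l)} (hF : F ⊆ F') {n : ℕ}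
    {t : L.Term (ℕ ⊕ Fin n)} (ht : TermAdm F t) : TermAdm F' t := by
  induction ht with
  | var x => exact .var x
  | func f ts hf _ ih => exact .func f ts (hF hf) ih
  | free f ts hf => exact TermAdm.relabel_inl F' (.func f ts)

/-- A subterm headed by a symbol outside `F ∩ F'` is headed by one outside `F` or outside `F'`, so
one of the hypotheses keeps slots out of it. This is what allows an axiom `C → C` across the
partition to be interpolated by `C`. -/
theorem TermAdm.inter {F F' : Set (Σ l : ℕ, L.Functions l)} {n : ℕ}
    {t : L.Term (ℕ ⊕ Fin n)} (ht : TermAdm F t) (ht' : TermAdm F' t) : TermAdm (F ∩ F') t := by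
  induction ht with
  | var x => exact .var x
  | free f ts hf => exact TermAdm.relabel_inl _ (.func f ts)
  | func f ts hf _ ih =>
    generalize hu : Term.func f ts = u at ht'
    cases ht' with
    | var x => cases hu
    | free g us hg => exact TermAdm.relabel_inl _ (.func g us)
    | func g us hg h =>
      cases hu
      exact .func f ts ⟨hf, hg⟩ fun i => ih i (h i)

theorem TermAdm.of_termFuncs {F : Set (Σ l : ℕ, L.Functions l)} {n : ℕ}
    {t : L.Term (ℕ ⊕ Fin n)} (ht : termFuncs t ⊆ F) : TermAdm F t := by
  induction t with
  | var x => exact .var x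
  | func f ts ih =>
    rw [termFuncs, Set.insert_subset_iff, Set.iUnion_subset_iff] at ht
    exact .func f ts ht.1 fun i => ih i (ht.2 i)

open Classical in
/-- Simultaneous replacement of the `F`-atoms and of the bound slots of a term. -/
noncomputable def tsub (F : Set (Σ l : ℕ, L.Functions l)) {n m : ℕ}
    (ψ : L.Term ℕ ⊕ Fin n → L.Term (ℕ ⊕ Fin m)) : L.Term (ℕ ⊕ Fin n) → L.Term (ℕ ⊕ Fin m)
  | .var (Sum.inl x) => ψ (Sum.inl (.var x))
  | .var (Sum.inr i) => ψ (Sum.inr i)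
  | .func (l := l) f ts =>
    if (⟨l, f⟩ : Σ l : ℕ, L.Functions l) ∈ F then .func f fun i => tsub F ψ (ts i)
    else ψ (Sum.inl (toFree (.func f ts)))

open Classical in
/-- The `F`-atoms of a term. -/
noncomputable def termAtoms (F : Set (Σ l : ℕ, L.Functions l)) {n : ℕ} :
    L.Term (ℕ ⊕ Fin n) → Set (L.Term ℕ)
  | .var (Sum.inl x) => {.var x}
  | .var (Sum.inr _) => ∅
  | .func (l := l) f ts =>
    if (⟨l, f⟩ : Σ l : ℕ, L.Functions l) ∈ F then ⋃ i, termAtoms F (ts i)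
    else {toFree (.func f ts)}

/-- The terms which are their own `F`-atom. -/
def IsAtom (F : Set (Σ l : ℕ, L.Functions l)) : L.Term ℕ → Prop
  | .var _ => True
  | .func (l := l) f _ => (⟨l, f⟩ : Σ l : ℕ, L.Functions l) ∉ F

section

variable {F : Set (Σ l : ℕ, L.Functions l)} {n m k : ℕ}

theorem tsub_func_mem (ψ : L.Term ℕ ⊕ Fin n → L.Term (ℕ ⊕ Fin m)) {l : ℕ} {f : L.Functions l}
    (hf : (⟨l, f⟩ : Σ l : ℕ, L.Functions l) ∈ F) (ts : Fin l → L.Term (ℕ ⊕ Fin n)) :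
    tsub F ψ (.func f ts) = .func f fun i => tsub F ψ (ts i) := by
  rw [tsub, if_pos hf]

theorem tsub_func_notMem (ψ : L.Term ℕ ⊕ Fin n → L.Term (ℕ ⊕ Fin m)) {l : ℕ}
    {f : L.Functions l} (hf : (⟨l, f⟩ : Σ l : ℕ, L.Functions l) ∉ F)
    (ts : Fin l → L.Term (ℕ ⊕ Fin n)) :
    tsub F ψ (.func f ts) = ψ (Sum.inl (toFree (.func f ts))) := by
  rw [tsub, if_neg hf]

theorem tsub_free (ψ : L.Term ℕ ⊕ Fin n → L.Term (ℕ ⊕ Fin m)) {l : ℕ}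
    {f : L.Functions l} (hf : (⟨l, f⟩ : Σ l : ℕ, L.Functions l) ∉ F) (ts : Fin l → L.Term ℕ) :
    tsub F ψ (.func f fun i => (ts i).relabel Sum.inl) = ψ (Sum.inl (.func f ts)) := by
  rw [tsub_func_notMem ψ hf]
  exact congrArg (fun s => ψ (Sum.inl s)) (toFree_relabel_inl (n := n) (.func f ts))

theorem termAtoms_func_mem {l : ℕ} {f : L.Functions l}
    (hf : (⟨l, f⟩ : Σ l : ℕ, L.Functions l) ∈ F) (ts : Fin l → L.Term (ℕ ⊕ Fin n)) :
    termAtoms F (.func f ts) = ⋃ i, termAtoms F (ts i) := by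
  rw [termAtoms, if_pos hf]

theorem termAtoms_func_notMem {l : ℕ} {f : L.Functions l}
    (hf : (⟨l, f⟩ : Σ l : ℕ, L.Functions l) ∉ F) (ts : Fin l → L.Term (ℕ ⊕ Fin n)) :
    termAtoms F (.func f ts) = {toFree (.func f ts)} := by
  rw [termAtoms, if_neg hf]

theorem termAtoms_free {l : ℕ} {f : L.Functions l}
    (hf : (⟨l, f⟩ : Σ l : ℕ, L.Functions l) ∉ F) (ts : Fin l → L.Term ℕ) :
    termAtoms F (.func f fun i => (ts i).relabel Sum.inl : L.Term (ℕ ⊕ Fin n)) =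
      {.func f ts} := by
  rw [termAtoms_func_notMem hf]
  exact congrArg _ (toFree_relabel_inl (n := n) (.func f ts))

theorem tsub_congr {ψ ψ' : L.Term ℕ ⊕ Fin n → L.Term (ℕ ⊕ Fin m)} {t : L.Term (ℕ ⊕ Fin n)}
    (h : ∀ s ∈ termAtoms F t, ψ (Sum.inl s) = ψ' (Sum.inl s))
    (h' : ∀ i, ψ (Sum.inr i) = ψ' (Sum.inr i)) : tsub F ψ t = tsub F ψ' t := by
  induction t with
  | var x =>
    rcases x with x | i
    · exact h _ rfl
    · exact h' i
  | @func l f ts ih =>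
    by_cases hf : (⟨l, f⟩ : Σ l : ℕ, L.Functions l) ∈ F
    · rw [termAtoms_func_mem hf] at h
      simp only [tsub_func_mem _ hf]
      congr 1
      funext i
      exact ih i fun s hs => h s (Set.mem_iUnion.2 ⟨i, hs⟩)
    · rw [termAtoms_func_notMem hf] at h
      simp only [tsub_func_notMem _ hf]
      exact h _ rfl

theorem subst_tsub (ψ : L.Term ℕ ⊕ Fin n → L.Term (ℕ ⊕ Fin m))
    (σ : ℕ ⊕ Fin m → L.Term (ℕ ⊕ Fin k)) (t : L.Term (ℕ ⊕ Fin n)) :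
    (tsub F ψ t).subst σ = tsub F (fun x => (ψ x).subst σ) t := by
  induction t with
  | var x => rcases x with x | i <;> rfl
  | @func l f ts ih =>
    by_cases hf : (⟨l, f⟩ : Σ l : ℕ, L.Functions l) ∈ F
    · simp only [tsub_func_mem _ hf, Term.subst, ih]
    · simp only [tsub_func_notMem _ hf]

theorem tsub_id {t : L.Term (ℕ ⊕ Fin n)} (ht : TermAdm F t)
    {ψ : L.Term ℕ ⊕ Fin n → L.Term (ℕ ⊕ Fin n)}
    (h : ∀ s ∈ termAtoms F t, ψ (Sum.inl s) = s.relabel Sum.inl)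
    (h' : ∀ i, ψ (Sum.inr i) = .var (Sum.inr i)) : tsub F ψ t = t := by
  induction ht with
  | var x =>
    rcases x with x | i
    · exact h _ rfl
    · exact h' i
  | func f ts hf _ ih =>
    rw [termAtoms_func_mem hf] at h
    simp only [tsub_func_mem _ hf]
    congr 1
    funext i
    exact ih i fun s hs => h s (Set.mem_iUnion.2 ⟨i, hs⟩)
  | free f ts hf =>
    rw [termAtoms_free hf] at h
    rw [tsub_free _ hf]
    exact h _ rfl

theorem subst_relabel_inl (σ : ℕ ⊕ Fin n → L.Term (ℕ ⊕ Fin m))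
    (h : ∀ x, σ (Sum.inl x) = .var (Sum.inl x)) (s : L.Term ℕ) :
    (s.relabel Sum.inl).subst σ = s.relabel Sum.inl := by
  induction s with
  | var x => exact h x
  | func f ts ih => simp only [Term.relabel, Term.subst, ih]

/-- The atoms of `t` contain no slots and `σ` fixes the free variables, so the atoms survive the
substitution unchanged. Without admissibility, filling a slot inside an atom would change the term
that `ψ` is applied to. -/
theorem tsub_subst {t : L.Term (ℕ ⊕ Fin n)} (ht : TermAdm F t)
    (σ : ℕ ⊕ Fin n → L.Term (ℕ ⊕ Fin m)) (hσ : ∀ x, σ (Sum.inl x) = .var (Sum.inl x))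
    (ψ : L.Term ℕ ⊕ Fin m → L.Term (ℕ ⊕ Fin k)) :
    tsub F ψ (t.subst σ) =
      tsub F (Sum.elim (fun s => ψ (Sum.inl s)) fun i => tsub F ψ (σ (Sum.inr i))) t := by
  induction ht with
  | var x =>
    rcases x with x | i
    · simp only [Term.subst, hσ, tsub, Sum.elim_inl]
    · rfl
  | func f ts hf _ ih => simp only [Term.subst, tsub_func_mem _ hf, ih]
  | free f ts hf =>
    simp only [Term.subst, subst_relabel_inl σ hσ, tsub_free _ hf, Sum.elim_inl]

theorem TermAdm.subst {t : L.Term (ℕ ⊕ Fin n)} (ht : TermAdm F t)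
    {σ : ℕ ⊕ Fin n → L.Term (ℕ ⊕ Fin m)} (hσ : ∀ x, σ (Sum.inl x) = .var (Sum.inl x))
    (hσ' : ∀ i, TermAdm F (σ (Sum.inr i))) : TermAdm F (t.subst σ) := by
  induction ht with
  | var x =>
    rcases x with x | i
    · simp only [Term.subst, hσ]; exact .var _
    · exact hσ' i
  | func f ts hf _ ih => exact .func f _ hf ih
  | free f ts hf =>
    simp only [Term.subst, subst_relabel_inl σ hσ]
    exact .free f ts hf

theorem TermAdm.tsub {t : L.Term (ℕ ⊕ Fin n)} (ht : TermAdm F t)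
    {ψ : L.Term ℕ ⊕ Fin n → L.Term (ℕ ⊕ Fin m)} (hψ : ∀ x, TermAdm F (ψ x)) :
    TermAdm F (tsub F ψ t) := by
  induction ht with
  | var x => rcases x with x | i <;> exact hψ _
  | func f ts hf _ ih => rw [tsub_func_mem _ hf]; exact .func f _ hf ih
  | free f ts hf => rw [tsub_free _ hf]; exact hψ _

theorem TermAdm.relabel_castSucc {t : L.Term (ℕ ⊕ Fin n)} (ht : TermAdm F t) :
    TermAdm F (t.relabel (Sum.map id Fin.castSucc) : L.Term (ℕ ⊕ Fin (n + 1))) := by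
  induction ht with
  | var x => exact .var _
  | func f ts hf _ ih => exact .func f _ hf ih
  | free f ts hf =>
    simp only [Term.relabel, Term.relabel_relabel]
    exact .free f ts hf

theorem termAtoms_relabel_castSucc (t : L.Term (ℕ ⊕ Fin n)) :
    termAtoms F (t.relabel (Sum.map id Fin.castSucc) : L.Term (ℕ ⊕ Fin (n + 1))) =
      termAtoms F t := by
  induction t with
  | var x => rcases x with x | i <;> rfl
  | @func l f ts ih =>
    by_cases hf : (⟨l, f⟩ : Σ l : ℕ, L.Functions l) ∈ F
    · simp only [Term.relabel, termAtoms_func_mem hf, ih]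
    · rw [termAtoms_func_notMem hf, ← toFree_relabel_castSucc]
      simp only [Term.relabel, termAtoms_func_notMem hf]

theorem termAtoms_relabel_inl {s : L.Term ℕ} (hs : IsAtom F s) :
    termAtoms F (s.relabel Sum.inl : L.Term (ℕ ⊕ Fin n)) = {s} := by
  cases s with
  | var x => rfl
  | func f ts => exact termAtoms_free hs ts

theorem isAtom_of_mem_termAtoms {t : L.Term (ℕ ⊕ Fin n)} {s : L.Term ℕ}
    (hs : s ∈ termAtoms F t) : IsAtom F s := by
  induction t with
  | var x =>
    rcases x with x | i
    · obtain rfl : s = .var x := hs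
      trivial
    · exact hs.elim
  | @func l f ts ih =>
    by_cases hf : (⟨l, f⟩ : Σ l : ℕ, L.Functions l) ∈ F
    · rw [termAtoms_func_mem hf] at hs
      obtain ⟨i, hi⟩ := Set.mem_iUnion.1 hs
      exact ih i hi
    · rw [termAtoms_func_notMem hf] at hs
      obtain rfl : s = _ := hs
      exact hf

theorem termAtoms_finite (t : L.Term (ℕ ⊕ Fin n)) : (termAtoms F t).Finite := by
  induction t with
  | var x =>
    rcases x with x | i
    · exact Set.finite_singleton _
    · exact Set.finite_empty
  | @func l f ts ih =>
    by_cases hf : (⟨l, f⟩ : Σ l : ℕ, L.Functions l) ∈ F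
    · rw [termAtoms_func_mem hf]
      exact Set.finite_iUnion ih
    · rw [termAtoms_func_notMem hf]
      exact Set.finite_singleton _

theorem mem_termAtoms_tsub {t : L.Term (ℕ ⊕ Fin n)}
    {ψ : L.Term ℕ ⊕ Fin n → L.Term (ℕ ⊕ Fin m)} {r : L.Term ℕ}
    (hr : r ∈ termAtoms F (tsub F ψ t)) :
    (∃ s ∈ termAtoms F t, r ∈ termAtoms F (ψ (Sum.inl s))) ∨
      ∃ i, r ∈ termAtoms F (ψ (Sum.inr i)) := by
  induction t with
  | var x =>
    rcases x with x | i
    · exact .inl ⟨_, rfl, hr⟩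
    · exact .inr ⟨i, hr⟩
  | @func l f ts ih =>
    by_cases hf : (⟨l, f⟩ : Σ l : ℕ, L.Functions l) ∈ F
    · rw [tsub_func_mem _ hf, termAtoms_func_mem hf] at hr
      obtain ⟨i, hi⟩ := Set.mem_iUnion.1 hr
      rw [termAtoms_func_mem hf]
      exact (ih i hi).imp_left fun ⟨s, hs, h⟩ => ⟨s, Set.mem_iUnion.2 ⟨i, hs⟩, h⟩
    · rw [tsub_func_notMem _ hf] at hr
      rw [termAtoms_func_notMem hf]
      exact .inl ⟨_, rfl, hr⟩

theorem mem_termAtoms_subst {t : L.Term (ℕ ⊕ Fin n)} (ht : TermAdm F t)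
    {σ : ℕ ⊕ Fin n → L.Term (ℕ ⊕ Fin m)} (hσ : ∀ x, σ (Sum.inl x) = .var (Sum.inl x))
    {r : L.Term ℕ} (hr : r ∈ termAtoms F (t.subst σ)) :
    r ∈ termAtoms F t ∨ ∃ i, r ∈ termAtoms F (σ (Sum.inr i)) := by
  induction ht with
  | var x =>
    rcases x with x | i
    · simp only [Term.subst, hσ] at hr; exact .inl hr
    · exact .inr ⟨i, hr⟩
  | func f ts hf _ ih =>
    simp only [Term.subst, termAtoms_func_mem hf, Set.mem_iUnion] at hr ⊢
    obtain ⟨i, hi⟩ := hr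
    exact (ih i hi).imp_left fun h => ⟨i, h⟩
  | free f ts hf =>
    simp only [Term.subst, subst_relabel_inl σ hσ] at hr
    rw [termAtoms_free hf] at hr ⊢
    exact .inl hr

theorem varFinsetLeft_relabel_inl (s : L.Term ℕ) :
    (s.relabel Sum.inl : L.Term (ℕ ⊕ Fin n)).varFinsetLeft = s.varFinset := by
  induction s with
  | var x => rfl
  | func f ts ih => simp only [Term.relabel, Term.varFinsetLeft, Term.varFinset, ih]

theorem mem_varFinsetLeft_of_mem_termAtoms {t : L.Term (ℕ ⊕ Fin n)} (ht : TermAdm F t)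
    {r : L.Term ℕ} (hr : r ∈ termAtoms F t) {a : ℕ} (ha : a ∈ r.varFinset) :
    a ∈ t.varFinsetLeft := by
  induction ht with
  | var x =>
    rcases x with x | i
    · obtain rfl : r = .var x := hr
      exact ha
    · exact hr.elim
  | func f ts hf _ ih =>
    rw [termAtoms_func_mem hf] at hr
    obtain ⟨i, hi⟩ := Set.mem_iUnion.1 hr
    exact Finset.mem_biUnion.2 ⟨i, Finset.mem_univ _, ih i hi⟩
  | free f ts hf =>
    rw [termAtoms_free hf] at hr
    obtain rfl : r = _ := hr
    have := varFinsetLeft_relabel_inl (n := n) (.func f ts)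
    rw [← this] at ha
    exact ha

theorem mem_varFinset_toFree {t : L.Term (ℕ ⊕ Fin n)} {a : ℕ} (ha : a ∈ t.varFinsetLeft) :
    a ∈ (toFree t).varFinset := by
  induction t with
  | var x =>
    rcases x with x | i
    · exact ha
    · simp at ha
  | func f ts ih =>
    obtain ⟨i, -, hi⟩ := Finset.mem_biUnion.1 ha
    exact Finset.mem_biUnion.2 ⟨i, Finset.mem_univ _, ih i hi⟩

theorem exists_mem_termAtoms {t : L.Term (ℕ ⊕ Fin n)} {a : ℕ} (ha : a ∈ t.varFinsetLeft) :
    ∃ r ∈ termAtoms F t, a ∈ r.varFinset := by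
  induction t with
  | var x =>
    rcases x with x | i
    · exact ⟨_, rfl, ha⟩
    · simp at ha
  | @func l f ts ih =>
    by_cases hf : (⟨l, f⟩ : Σ l : ℕ, L.Functions l) ∈ F
    · obtain ⟨i, -, hi⟩ := Finset.mem_biUnion.1 ha
      obtain ⟨r, hr, h⟩ := ih i hi
      rw [termAtoms_func_mem hf]
      exact ⟨r, Set.mem_iUnion.2 ⟨i, hr⟩, h⟩
    · rw [termAtoms_func_notMem hf]
      exact ⟨_, rfl, mem_varFinset_toFree ha⟩

theorem termFuncs_subset_of_termAtoms {t : L.Term (ℕ ⊕ Fin n)}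
    (h : ∀ r ∈ termAtoms F t, ∃ x, r = .var x) : termFuncs t ⊆ F := by
  induction t with
  | var x => simp [termFuncs]
  | @func l f ts ih =>
    by_cases hf : (⟨l, f⟩ : Σ l : ℕ, L.Functions l) ∈ F
    · rw [termAtoms_func_mem hf] at h
      rw [termFuncs, Set.insert_subset_iff, Set.iUnion_subset_iff]
      exact ⟨hf, fun i => ih i fun r hr => h r (Set.mem_iUnion.2 ⟨i, hr⟩)⟩
    · rw [termAtoms_func_notMem hf] at h
      obtain ⟨x, hx⟩ := h _ rfl
      cases hx

/-! ### Subterms and the replacement of a single atom. -/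

/-- `r` is a subterm of a term. -/
def IsSubterm (r : L.Term ℕ) : L.Term ℕ → Prop
  | .var x => r = .var x
  | .func f ts => r = .func f ts ∨ ∃ i, IsSubterm r (ts i)

/-- The number of symbols of a term. -/
def termSize : L.Term ℕ → ℕ
  | .var _ => 1
  | .func _ ts => 1 + ∑ i, termSize (ts i)

theorem IsSubterm.eq_or_termSize_lt {r s : L.Term ℕ} (h : IsSubterm r s) :
    r = s ∨ termSize r < termSize s := by
  induction s with
  | var x => exact .inl h
  | func f ts ih =>
    refine h.imp_right fun ⟨i, hi⟩ => ?_
    have h₁ : termSize (ts i) ≤ ∑ j, termSize (ts j) :=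
      Finset.single_le_sum (f := fun j => termSize (ts j)) (fun _ _ => Nat.zero_le _)
        (Finset.mem_univ i)
    rw [termSize]
    rcases ih i hi with rfl | h₂ <;> omega

theorem IsSubterm.varFinset_subset {r s : L.Term ℕ} (h : IsSubterm r s) {a : ℕ}
    (ha : a ∈ r.varFinset) : a ∈ s.varFinset := by
  induction s with
  | var x => obtain rfl : r = _ := h; exact ha
  | func f ts ih =>
    rcases h with rfl | ⟨i, hi⟩
    · exact ha
    · exact Finset.mem_biUnion.2 ⟨i, Finset.mem_univ _, ih i hi⟩

open Classical in
/-- The replacement of the atom `r` by the term `t`. -/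
noncomputable def repl (r : L.Term ℕ) (t : L.Term (ℕ ⊕ Fin m)) (s : L.Term ℕ) :
    L.Term (ℕ ⊕ Fin m) :=
  if s = r then t else s.relabel Sum.inl

theorem repl_self (r : L.Term ℕ) (t : L.Term (ℕ ⊕ Fin m)) : repl r t r = t := if_pos rfl

theorem repl_of_ne {r s : L.Term ℕ} (h : s ≠ r) (t : L.Term (ℕ ⊕ Fin m)) :
    repl r t s = s.relabel Sum.inl := if_neg h

/-- Every `F`-atom of `s` is a subterm of `s`, whatever `F` is, so none of them is `r`. -/
theorem tsub_repl_of_not_isSubterm {r s : L.Term ℕ} (h : ¬ IsSubterm r s)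
    (t : L.Term (ℕ ⊕ Fin 0)) :
    tsub F (Sum.elim (repl r t) Fin.elim0) (s.relabel Sum.inl) = s.relabel Sum.inl := by
  induction s with
  | var x => exact repl_of_ne (fun e => h e.symm) t
  | @func l f ts ih =>
    by_cases hf : (⟨l, f⟩ : Σ l : ℕ, L.Functions l) ∈ F
    · simp only [Term.relabel, tsub_func_mem _ hf]
      congr 1
      funext i
      exact ih i fun hi => h (.inr ⟨i, hi⟩)
    · simp only [Term.relabel, tsub_free _ hf]
      exact repl_of_ne (fun e => h (.inl e.symm)) t

theorem tsub_repl_relabel_inl {r : L.Term ℕ} (hr : IsAtom F r) (t : L.Term (ℕ ⊕ Fin 0)) :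
    tsub F (Sum.elim (repl r t) Fin.elim0) (r.relabel Sum.inl) = t := by
  cases r with
  | var x => exact repl_self _ t
  | func f ts =>
    simp only [Term.relabel]
    rw [tsub_free _ hr]
    exact repl_self _ t

/-! ### Replacements under quantifiers. -/

/-- A replacement pushed under a quantifier: the new last slot is left alone. -/
def liftSub (ψ : L.Term ℕ ⊕ Fin n → L.Term (ℕ ⊕ Fin m)) :
    L.Term ℕ ⊕ Fin (n + 1) → L.Term (ℕ ⊕ Fin (m + 1)) :=
  Sum.elim
    (fun s => (ψ (Sum.inl s)).relabel (Sum.map id Fin.castSucc))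
    (Fin.lastCases (.var (Sum.inr (Fin.last m)))
      fun i => (ψ (Sum.inr i)).relabel (Sum.map id Fin.castSucc))

theorem relabel_castSucc_subst (σ : ℕ ⊕ Fin n → L.Term (ℕ ⊕ Fin m)) (t : L.Term (ℕ ⊕ Fin n)) :
    (t.relabel (Sum.map id Fin.castSucc)).subst (Formula.liftSubst σ) =
      (t.subst σ).relabel (Sum.map id Fin.castSucc) := by
  induction t with
  | var x => rcases x with x | i <;> simp [Term.subst, Formula.liftSubst]
  | func f ts ih => simp only [Term.relabel, Term.subst, ih]

theorem liftSub_subst (ψ : L.Term ℕ ⊕ Fin n → L.Term (ℕ ⊕ Fin m))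
    (σ : ℕ ⊕ Fin m → L.Term (ℕ ⊕ Fin k)) :
    (fun x => (liftSub ψ x).subst (Formula.liftSubst σ)) =
      liftSub fun x => (ψ x).subst σ := by
  funext x
  rcases x with s | i
  · exact relabel_castSucc_subst σ _
  · refine Fin.lastCases ?_ (fun i => ?_) i
    · simp [liftSub, Term.subst, Formula.liftSubst]
    · simp only [liftSub, Sum.elim_inr, Fin.lastCases_castSucc, relabel_castSucc_subst]

theorem tsub_liftSub_relabel (ψ : L.Term ℕ ⊕ Fin n → L.Term (ℕ ⊕ Fin m))
    (t : L.Term (ℕ ⊕ Fin n)) :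
    tsub F (liftSub ψ) (t.relabel (Sum.map id Fin.castSucc)) =
      (tsub F ψ t).relabel (Sum.map id Fin.castSucc) := by
  induction t with
  | var x => rcases x with x | i <;> simp [tsub, liftSub]
  | @func l f ts ih =>
    by_cases hf : (⟨l, f⟩ : Σ l : ℕ, L.Functions l) ∈ F
    · simp only [Term.relabel, tsub_func_mem _ hf, ih]
    · rw [tsub_func_notMem _ hf, ← toFree_relabel_castSucc]
      simp only [Term.relabel, tsub_func_notMem _ hf, liftSub, Sum.elim_inl]

theorem liftSub_tsub (ψ : L.Term ℕ ⊕ Fin m → L.Term (ℕ ⊕ Fin k))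
    (σ : ℕ ⊕ Fin n → L.Term (ℕ ⊕ Fin m)) :
    (Sum.elim (fun s => liftSub ψ (Sum.inl s)) fun i =>
        tsub F (liftSub ψ) (Formula.liftSubst σ (Sum.inr i))) =
      liftSub (Sum.elim (fun s => ψ (Sum.inl s)) fun i => tsub F ψ (σ (Sum.inr i))) := by
  funext x
  rcases x with s | i
  · rfl
  · refine Fin.lastCases ?_ (fun i => ?_) i
    · simp [liftSub, tsub, Formula.liftSubst]
    · simp only [liftSub, Sum.elim_inr, Fin.lastCases_castSucc, Formula.liftSubst]
      exact tsub_liftSub_relabel ψ _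

theorem liftSubst_inl {σ : ℕ ⊕ Fin n → L.Term (ℕ ⊕ Fin m)}
    (hσ : ∀ x, σ (Sum.inl x) = .var (Sum.inl x)) (x : ℕ) :
    Formula.liftSubst σ (Sum.inl x) = .var (Sum.inl x) := by
  simp [Formula.liftSubst, hσ]

end

/-! ### Formulas relative to a set of function symbols -/

namespace Formula

/-- All predicate symbols are in `P`, and no subterm headed by a function symbol outside `F`
contains a bound slot. -/
def Adm (P : Set (PredSymbol L)) (F : Set (Σ l : ℕ, L.Functions l)) :
    {n : ℕ} → Formula L n → Prop
  | _, top => PredSymbol.top ∈ P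
  | _, bot => PredSymbol.bot ∈ P
  | _, rel R ts => PredSymbol.rel R ∈ P ∧ ∀ i, TermAdm F (ts i)
  | _, neg A => A.Adm P F
  | _, and A B => A.Adm P F ∧ B.Adm P F
  | _, or A B => A.Adm P F ∧ B.Adm P F
  | _, all A => A.Adm P F
  | _, ex A => A.Adm P F

/-- The `F`-atoms of the terms of a formula. -/
noncomputable def atoms (F : Set (Σ l : ℕ, L.Functions l)) :
    {n : ℕ} → Formula L n → Set (L.Term ℕ)
  | _, top => ∅
  | _, bot => ∅
  | _, rel _ ts => ⋃ i, termAtoms F (ts i)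
  | _, neg A => A.atoms F
  | _, and A B => A.atoms F ∪ B.atoms F
  | _, or A B => A.atoms F ∪ B.atoms F
  | _, all A => A.atoms F
  | _, ex A => A.atoms F

/-- Simultaneous replacement of the `F`-atoms and of the bound slots of a formula. -/
noncomputable def gsub (F : Set (Σ l : ℕ, L.Functions l)) :
    {n m : ℕ} → Formula L n → (L.Term ℕ ⊕ Fin n → L.Term (ℕ ⊕ Fin m)) → Formula L m
  | _, _, top, _ => top
  | _, _, bot, _ => bot
  | _, _, rel R ts, ψ => rel R fun i => tsub F ψ (ts i)
  | _, _, neg A, ψ => neg (A.gsub F ψ)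
  | _, _, and A B, ψ => and (A.gsub F ψ) (B.gsub F ψ)
  | _, _, or A B, ψ => or (A.gsub F ψ) (B.gsub F ψ)
  | _, _, all A, ψ => all (A.gsub F (liftSub ψ))
  | _, _, ex A, ψ => ex (A.gsub F (liftSub ψ))

section

variable {P P' : Set (PredSymbol L)} {F F' : Set (Σ l : ℕ, L.Functions l)} {n m k : ℕ}

theorem Adm.mono (hP : P ⊆ P') (hF : F ⊆ F') {A : Formula L n} (hA : A.Adm P F) :
    A.Adm P' F' := by
  induction A with
  | top => exact hP hA
  | bot => exact hP hA
  | rel R ts => exact ⟨hP hA.1, fun i => (hA.2 i).mono hF⟩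
  | neg A ih => exact ih hA
  | and A B ihA ihB => exact ⟨ihA hA.1, ihB hA.2⟩
  | or A B ihA ihB => exact ⟨ihA hA.1, ihB hA.2⟩
  | all A ih => exact ih hA
  | ex A ih => exact ih hA

theorem Adm.inter {A : Formula L n} (hA : A.Adm P F) (hA' : A.Adm P' F') :
    A.Adm (P ∩ P') (F ∩ F') := by
  induction A with
  | top => exact ⟨hA, hA'⟩
  | bot => exact ⟨hA, hA'⟩
  | rel R ts => exact ⟨⟨hA.1, hA'.1⟩, fun i => (hA.2 i).inter (hA'.2 i)⟩
  | neg A ih => exact ih hA hA'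
  | and A B ihA ihB => exact ⟨ihA hA.1 hA'.1, ihB hA.2 hA'.2⟩
  | or A B ihA ihB => exact ⟨ihA hA.1 hA'.1, ihB hA.2 hA'.2⟩
  | all A ih => exact ih hA hA'
  | ex A ih => exact ih hA hA'

theorem adm_of_subset {A : Formula L n} (hP : A.preds ⊆ P) (hF : A.funcs ⊆ F) : A.Adm P F := by
  induction A with
  | top => exact hP rfl
  | bot => exact hP rfl
  | rel R ts =>
    exact ⟨hP rfl, fun i => TermAdm.of_termFuncs ((Set.subset_iUnion _ i).trans hF)⟩
  | neg A ih => exact ih hP hF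
  | and A B ihA ihB =>
    exact ⟨ihA (Set.union_subset_iff.1 hP).1 (Set.union_subset_iff.1 hF).1,
      ihB (Set.union_subset_iff.1 hP).2 (Set.union_subset_iff.1 hF).2⟩
  | or A B ihA ihB =>
    exact ⟨ihA (Set.union_subset_iff.1 hP).1 (Set.union_subset_iff.1 hF).1,
      ihB (Set.union_subset_iff.1 hP).2 (Set.union_subset_iff.1 hF).2⟩
  | all A ih => exact ih hP hF
  | ex A ih => exact ih hP hF

theorem Adm.preds_subset {A : Formula L n} (hA : A.Adm P F) : A.preds ⊆ P := by
  induction A with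
  | top => exact Set.singleton_subset_iff.2 hA
  | bot => exact Set.singleton_subset_iff.2 hA
  | rel R ts => exact Set.singleton_subset_iff.2 hA.1
  | neg A ih => exact ih hA
  | and A B ihA ihB => exact Set.union_subset (ihA hA.1) (ihB hA.2)
  | or A B ihA ihB => exact Set.union_subset (ihA hA.1) (ihB hA.2)
  | all A ih => exact ih hA
  | ex A ih => exact ih hA

theorem preds_nonempty (A : Formula L n) : A.preds.Nonempty := by
  induction A with
  | top => exact ⟨_, rfl⟩
  | bot => exact ⟨_, rfl⟩
  | rel R ts => exact ⟨_, rfl⟩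
  | neg A ih => exact ih
  | and A B ihA ihB => exact ihA.inl
  | or A B ihA ihB => exact ihA.inl
  | all A ih => exact ih
  | ex A ih => exact ih

theorem preds_subst (A : Formula L n) (σ : ℕ ⊕ Fin n → L.Term (ℕ ⊕ Fin m)) :
    (A.subst σ).preds = A.preds := by
  induction A generalizing m with
  | top => rfl
  | bot => rfl
  | rel R ts => rfl
  | neg A ih => exact ih σ
  | and A B ihA ihB => exact congrArg₂ _ (ihA σ) (ihB σ)
  | or A B ihA ihB => exact congrArg₂ _ (ihA σ) (ihB σ)
  | all A ih => exact ih _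
  | ex A ih => exact ih _

theorem preds_inst (A : Formula L 1) (t : L.Term ℕ) : (A.inst t).preds = A.preds :=
  preds_subst A _

theorem liftSubst_adm {σ : ℕ ⊕ Fin n → L.Term (ℕ ⊕ Fin m)}
    (hσ' : ∀ i, TermAdm F (σ (Sum.inr i))) (i : Fin (n + 1)) :
    TermAdm F (liftSubst σ (Sum.inr i)) := by
  refine Fin.lastCases ?_ (fun i => ?_) i
  · simp only [liftSubst, Sum.elim_inr, Fin.lastCases_last]; exact .var _
  · simp only [liftSubst, Sum.elim_inr, Fin.lastCases_castSucc]; exact (hσ' i).relabel_castSucc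

theorem Adm.subst {A : Formula L n} (hA : A.Adm P F) {σ : ℕ ⊕ Fin n → L.Term (ℕ ⊕ Fin m)}
    (hσ : ∀ x, σ (Sum.inl x) = .var (Sum.inl x)) (hσ' : ∀ i, TermAdm F (σ (Sum.inr i))) :
    (A.subst σ).Adm P F := by
  induction A generalizing m with
  | top => exact hA
  | bot => exact hA
  | rel R ts => exact ⟨hA.1, fun i => (hA.2 i).subst hσ hσ'⟩
  | neg A ih => exact ih hA hσ hσ'
  | and A B ihA ihB => exact ⟨ihA hA.1 hσ hσ', ihB hA.2 hσ hσ'⟩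
  | or A B ihA ihB => exact ⟨ihA hA.1 hσ hσ', ihB hA.2 hσ hσ'⟩
  | all A ih => exact ih hA (liftSubst_inl hσ) (liftSubst_adm hσ')
  | ex A ih => exact ih hA (liftSubst_inl hσ) (liftSubst_adm hσ')

theorem Adm.inst {A : Formula L 1} (hA : A.Adm P F) (t : L.Term ℕ) : (A.inst t).Adm P F :=
  Adm.subst hA (fun _ => rfl) fun _ => TermAdm.relabel_inl F t

theorem Adm.gsub {A : Formula L n} (hA : A.Adm P F)
    {ψ : L.Term ℕ ⊕ Fin n → L.Term (ℕ ⊕ Fin m)} (hψ : ∀ x, TermAdm F (ψ x)) :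
    (A.gsub F ψ).Adm P F := by
  have hl : ∀ {n m : ℕ} {ψ : L.Term ℕ ⊕ Fin n → L.Term (ℕ ⊕ Fin m)},
      (∀ x, TermAdm F (ψ x)) → ∀ x, TermAdm F (liftSub ψ x) := by
    intro n m ψ hψ x
    rcases x with s | i
    · exact (hψ _).relabel_castSucc
    · refine Fin.lastCases ?_ (fun i => ?_) i
      · simp only [liftSub, Sum.elim_inr, Fin.lastCases_last]; exact .var _
      · simp only [liftSub, Sum.elim_inr, Fin.lastCases_castSucc]
        exact (hψ _).relabel_castSucc
  induction A generalizing m with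
  | top => exact hA
  | bot => exact hA
  | rel R ts => exact ⟨hA.1, fun i => (hA.2 i).tsub hψ⟩
  | neg A ih => exact ih hA hψ
  | and A B ihA ihB => exact ⟨ihA hA.1 hψ, ihB hA.2 hψ⟩
  | or A B ihA ihB => exact ⟨ihA hA.1 hψ, ihB hA.2 hψ⟩
  | all A ih => exact ih hA (hl hψ)
  | ex A ih => exact ih hA (hl hψ)

theorem gsub_congr {A : Formula L n} {ψ ψ' : L.Term ℕ ⊕ Fin n → L.Term (ℕ ⊕ Fin m)}
    (h : ∀ s ∈ A.atoms F, ψ (Sum.inl s) = ψ' (Sum.inl s))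
    (h' : ∀ i, ψ (Sum.inr i) = ψ' (Sum.inr i)) : A.gsub F ψ = A.gsub F ψ' := by
  have hl : ∀ {n m : ℕ} {ψ ψ' : L.Term ℕ ⊕ Fin n → L.Term (ℕ ⊕ Fin m)},
      (∀ i, ψ (Sum.inr i) = ψ' (Sum.inr i)) →
        ∀ i, liftSub ψ (Sum.inr i) = liftSub ψ' (Sum.inr i) := by
    intro n m ψ ψ' h' i
    refine Fin.lastCases ?_ (fun i => ?_) i <;> simp [liftSub, h']
  induction A generalizing m with
  | top => rfl
  | bot => rfl
  | rel R ts =>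
    exact congrArg (rel R) (funext fun i => tsub_congr
      (fun s hs => h s (Set.mem_iUnion.2 ⟨i, hs⟩)) h')
  | neg A ih => exact congrArg neg (ih h h')
  | and A B ihA ihB =>
    exact congrArg₂ and (ihA (fun s hs => h s (.inl hs)) h') (ihB (fun s hs => h s (.inr hs)) h')
  | or A B ihA ihB =>
    exact congrArg₂ or (ihA (fun s hs => h s (.inl hs)) h') (ihB (fun s hs => h s (.inr hs)) h')
  | all A ih =>
    exact congrArg all (ih (fun s hs => congrArg (Term.relabel _) (h s hs)) (hl h'))
  | ex A ih =>
    exact congrArg ex (ih (fun s hs => congrArg (Term.relabel _) (h s hs)) (hl h'))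

theorem subst_gsub (A : Formula L n) (ψ : L.Term ℕ ⊕ Fin n → L.Term (ℕ ⊕ Fin m))
    (σ : ℕ ⊕ Fin m → L.Term (ℕ ⊕ Fin k)) :
    (A.gsub F ψ).subst σ = A.gsub F fun x => (ψ x).subst σ := by
  induction A generalizing m k with
  | top => rfl
  | bot => rfl
  | rel R ts => exact congrArg (rel R) (funext fun i => subst_tsub ψ σ _)
  | neg A ih => exact congrArg neg (ih ψ σ)
  | and A B ihA ihB => exact congrArg₂ and (ihA ψ σ) (ihB ψ σ)
  | or A B ihA ihB => exact congrArg₂ or (ihA ψ σ) (ihB ψ σ)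
  | all A ih => rw [gsub, Formula.subst, ih, liftSub_subst, gsub]
  | ex A ih => rw [gsub, Formula.subst, ih, liftSub_subst, gsub]

theorem gsub_id {A : Formula L n} (hA : A.Adm P F)
    {ψ : L.Term ℕ ⊕ Fin n → L.Term (ℕ ⊕ Fin n)}
    (h : ∀ s ∈ A.atoms F, ψ (Sum.inl s) = s.relabel Sum.inl)
    (h' : ∀ i, ψ (Sum.inr i) = .var (Sum.inr i)) : A.gsub F ψ = A := by
  have hl : ∀ {n : ℕ} {ψ : L.Term ℕ ⊕ Fin n → L.Term (ℕ ⊕ Fin n)} {s : L.Term ℕ},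
      ψ (Sum.inl s) = s.relabel Sum.inl → liftSub ψ (Sum.inl s) = s.relabel Sum.inl := by
    intro n ψ s h
    simp only [liftSub, Sum.elim_inl, h, Term.relabel_relabel]
    rfl
  have hl' : ∀ {n : ℕ} {ψ : L.Term ℕ ⊕ Fin n → L.Term (ℕ ⊕ Fin n)},
      (∀ i, ψ (Sum.inr i) = .var (Sum.inr i)) →
        ∀ i, liftSub ψ (Sum.inr i) = .var (Sum.inr i) := by
    intro n ψ h' i
    refine Fin.lastCases ?_ (fun i => ?_) i <;> simp [liftSub, h']
  induction A with
  | top => rfl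
  | bot => rfl
  | rel R ts =>
    exact congrArg (rel R) (funext fun i => tsub_id (hA.2 i)
      (fun s hs => h s (Set.mem_iUnion.2 ⟨i, hs⟩)) h')
  | neg A ih => exact congrArg neg (ih hA h h')
  | and A B ihA ihB =>
    exact congrArg₂ and (ihA hA.1 (fun s hs => h s (.inl hs)) h')
      (ihB hA.2 (fun s hs => h s (.inr hs)) h')
  | or A B ihA ihB =>
    exact congrArg₂ or (ihA hA.1 (fun s hs => h s (.inl hs)) h')
      (ihB hA.2 (fun s hs => h s (.inr hs)) h')
  | all A ih => exact congrArg all (ih hA (fun s hs => hl (h s hs)) (hl' h'))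
  | ex A ih => exact congrArg ex (ih hA (fun s hs => hl (h s hs)) (hl' h'))

theorem gsub_subst {A : Formula L n} (hA : A.Adm P F)
    (σ : ℕ ⊕ Fin n → L.Term (ℕ ⊕ Fin m)) (hσ : ∀ x, σ (Sum.inl x) = .var (Sum.inl x))
    (ψ : L.Term ℕ ⊕ Fin m → L.Term (ℕ ⊕ Fin k)) :
    (A.subst σ).gsub F ψ =
      A.gsub F (Sum.elim (fun s => ψ (Sum.inl s)) fun i => tsub F ψ (σ (Sum.inr i))) := by
  induction A generalizing m k with
  | top => rfl
  | bot => rfl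
  | rel R ts => exact congrArg (rel R) (funext fun i => tsub_subst (hA.2 i) σ hσ ψ)
  | neg A ih => exact congrArg neg (ih hA σ hσ ψ)
  | and A B ihA ihB => exact congrArg₂ and (ihA hA.1 σ hσ ψ) (ihB hA.2 σ hσ ψ)
  | or A B ihA ihB => exact congrArg₂ or (ihA hA.1 σ hσ ψ) (ihB hA.2 σ hσ ψ)
  | all A ih =>
    rw [Formula.subst, gsub, ih hA _ (liftSubst_inl hσ), liftSub_tsub, gsub]
  | ex A ih =>
    rw [Formula.subst, gsub, ih hA _ (liftSubst_inl hσ), liftSub_tsub, gsub]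

theorem relabel_castSucc_subst_zero (t : L.Term (ℕ ⊕ Fin 0)) (u : L.Term (ℕ ⊕ Fin 0)) :
    (t.relabel (Sum.map id Fin.castSucc)).subst
      (Sum.elim (fun x => .var (Sum.inl x)) fun _ => u) = t := by
  induction t with
  | var x =>
    rcases x with x | i
    · rfl
    · exact i.elim0
  | func f ts ih => simp only [Term.relabel, Term.subst, ih]

/-- The reason why the quantifier rules survive a replacement: the instance at `t` becomes the
instance at the replaced `t`. No restriction on the function symbols of `t` is needed. -/
theorem gsub_inst {A : Formula L 1} (hA : A.Adm P F) (t : L.Term ℕ)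
    (ψ : L.Term ℕ ⊕ Fin 0 → L.Term (ℕ ⊕ Fin 0)) :
    (A.inst t).gsub F ψ =
      (A.gsub F (liftSub ψ)).inst (toFree (tsub F ψ (t.relabel Sum.inl))) := by
  rw [Formula.inst, gsub_subst hA (Sum.elim (fun x => .var (Sum.inl x)) fun _ => t.relabel Sum.inl) (fun _ => rfl),
    Formula.inst, subst_gsub]
  congr 1
  funext x
  rcases x with s | i
  · exact (relabel_castSucc_subst_zero _ _).symm
  · obtain rfl : i = Fin.last 0 := Subsingleton.elim _ _
    simp only [liftSub, Sum.elim_inr, Fin.lastCases_last, Term.subst, relabel_inl_toFree]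

theorem mem_atoms_subst {A : Formula L n} (hA : A.Adm P F)
    {σ : ℕ ⊕ Fin n → L.Term (ℕ ⊕ Fin m)} (hσ : ∀ x, σ (Sum.inl x) = .var (Sum.inl x))
    {r : L.Term ℕ} (hr : r ∈ (A.subst σ).atoms F) :
    r ∈ A.atoms F ∨ ∃ i, r ∈ termAtoms F (σ (Sum.inr i)) := by
  have hl : ∀ {n m : ℕ} {σ : ℕ ⊕ Fin n → L.Term (ℕ ⊕ Fin m)},
      (∃ i, r ∈ termAtoms F (liftSubst σ (Sum.inr i))) →
        ∃ i, r ∈ termAtoms F (σ (Sum.inr i)) := by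
    rintro n m σ ⟨i, hi⟩
    revert hi
    refine Fin.lastCases (fun hi => ?_) (fun i hi => ?_) i
    · simp only [liftSubst, Sum.elim_inr, Fin.lastCases_last] at hi
      exact hi.elim
    · simp only [liftSubst, Sum.elim_inr, Fin.lastCases_castSucc,
        termAtoms_relabel_castSucc] at hi
      exact ⟨i, hi⟩
  induction A generalizing m with
  | top => exact hr.elim
  | bot => exact hr.elim
  | rel R ts =>
    obtain ⟨i, hi⟩ := Set.mem_iUnion.1 hr
    exact (mem_termAtoms_subst (hA.2 i) hσ hi).imp_left fun h => Set.mem_iUnion.2 ⟨i, h⟩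
  | neg A ih => exact ih hA hσ hr
  | and A B ihA ihB =>
    rcases hr with hr | hr
    · exact (ihA hA.1 hσ hr).imp_left .inl
    · exact (ihB hA.2 hσ hr).imp_left .inr
  | or A B ihA ihB =>
    rcases hr with hr | hr
    · exact (ihA hA.1 hσ hr).imp_left .inl
    · exact (ihB hA.2 hσ hr).imp_left .inr
  | all A ih => exact (ih hA (liftSubst_inl hσ) hr).imp_right hl
  | ex A ih => exact (ih hA (liftSubst_inl hσ) hr).imp_right hl

theorem mem_atoms_inst_var {A : Formula L 1} (hA : A.Adm P F) {a : ℕ} {r : L.Term ℕ}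
    (hr : r ∈ (A.inst (.var a)).atoms F) : r ∈ A.atoms F ∨ r = .var a :=
  (mem_atoms_subst hA
    (σ := Sum.elim (fun x => .var (Sum.inl x)) fun _ => Term.relabel Sum.inl (.var a))
    (fun _ => rfl) hr).imp_right fun ⟨_, hi⟩ => hi

theorem mem_atoms_gsub {A : Formula L n} {ψ : L.Term ℕ ⊕ Fin n → L.Term (ℕ ⊕ Fin m)}
    {r : L.Term ℕ} (hr : r ∈ (A.gsub F ψ).atoms F) :
    (∃ s ∈ A.atoms F, r ∈ termAtoms F (ψ (Sum.inl s))) ∨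
      ∃ i, r ∈ termAtoms F (ψ (Sum.inr i)) := by
  have hl : ∀ {n m : ℕ} {S : Set (L.Term ℕ)} {ψ : L.Term ℕ ⊕ Fin n → L.Term (ℕ ⊕ Fin m)},
      ((∃ s ∈ S, r ∈ termAtoms F (liftSub ψ (Sum.inl s))) ∨
        ∃ i, r ∈ termAtoms F (liftSub ψ (Sum.inr i))) →
      (∃ s ∈ S, r ∈ termAtoms F (ψ (Sum.inl s))) ∨ ∃ i, r ∈ termAtoms F (ψ (Sum.inr i)) := by
    rintro n m S ψ (⟨s, hs, h⟩ | ⟨i, hi⟩)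
    · simp only [liftSub, Sum.elim_inl, termAtoms_relabel_castSucc] at h
      exact .inl ⟨s, hs, h⟩
    · revert hi
      refine Fin.lastCases (fun hi => ?_) (fun i hi => ?_) i
      · simp only [liftSub, Sum.elim_inr, Fin.lastCases_last] at hi
        exact hi.elim
      · simp only [liftSub, Sum.elim_inr, Fin.lastCases_castSucc,
          termAtoms_relabel_castSucc] at hi
        exact .inr ⟨i, hi⟩
  induction A generalizing m with
  | top => exact hr.elim
  | bot => exact hr.elim
  | rel R ts =>
    obtain ⟨i, hi⟩ := Set.mem_iUnion.1 hr
    exact (mem_termAtoms_tsub hi).imp_left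
      fun ⟨s, hs, h⟩ => ⟨s, Set.mem_iUnion.2 ⟨i, hs⟩, h⟩
  | neg A ih => exact ih hr
  | and A B ihA ihB =>
    rcases hr with hr | hr
    · exact (ihA hr).imp_left fun ⟨s, hs, h⟩ => ⟨s, .inl hs, h⟩
    · exact (ihB hr).imp_left fun ⟨s, hs, h⟩ => ⟨s, .inr hs, h⟩
  | or A B ihA ihB =>
    rcases hr with hr | hr
    · exact (ihA hr).imp_left fun ⟨s, hs, h⟩ => ⟨s, .inl hs, h⟩
    · exact (ihB hr).imp_left fun ⟨s, hs, h⟩ => ⟨s, .inr hs, h⟩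
  | all A ih => exact hl (ih hr)
  | ex A ih => exact hl (ih hr)

theorem isAtom_of_mem_atoms {A : Formula L n} {s : L.Term ℕ} (hs : s ∈ A.atoms F) :
    IsAtom F s := by
  induction A with
  | top => exact hs.elim
  | bot => exact hs.elim
  | rel R ts =>
    obtain ⟨i, hi⟩ := Set.mem_iUnion.1 hs
    exact isAtom_of_mem_termAtoms hi
  | neg A ih => exact ih hs
  | and A B ihA ihB => exact hs.elim ihA ihB
  | or A B ihA ihB => exact hs.elim ihA ihB
  | all A ih => exact ih hs
  | ex A ih => exact ih hs

theorem atoms_finite (A : Formula L n) : (A.atoms F).Finite := by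
  induction A with
  | top => exact Set.finite_empty
  | bot => exact Set.finite_empty
  | rel R ts => exact Set.finite_iUnion fun i => termAtoms_finite _
  | neg A ih => exact ih
  | and A B ihA ihB => exact ihA.union ihB
  | or A B ihA ihB => exact ihA.union ihB
  | all A ih => exact ih
  | ex A ih => exact ih

theorem freeVars_finite (A : Formula L n) : A.freeVars.Finite := by
  induction A with
  | top => exact Set.finite_empty
  | bot => exact Set.finite_empty
  | rel R ts => exact Set.finite_iUnion fun i => Finset.finite_toSet _
  | neg A ih => exact ih
  | and A B ihA ihB => exact ihA.union ihB
  | or A B ihA ihB => exact ihA.union ihB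
  | all A ih => exact ih
  | ex A ih => exact ih

theorem mem_freeVars_of_mem_atoms {A : Formula L n} (hA : A.Adm P F) {r : L.Term ℕ}
    (hr : r ∈ A.atoms F) {a : ℕ} (ha : a ∈ r.varFinset) : a ∈ A.freeVars := by
  induction A with
  | top => exact hr.elim
  | bot => exact hr.elim
  | rel R ts =>
    obtain ⟨i, hi⟩ := Set.mem_iUnion.1 hr
    exact Set.mem_iUnion.2 ⟨i, mem_varFinsetLeft_of_mem_termAtoms (hA.2 i) hi ha⟩
  | neg A ih => exact ih hA hr
  | and A B ihA ihB => exact hr.imp (ihA hA.1) (ihB hA.2)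
  | or A B ihA ihB => exact hr.imp (ihA hA.1) (ihB hA.2)
  | all A ih => exact ih hA hr
  | ex A ih => exact ih hA hr

theorem exists_mem_atoms {A : Formula L n} {a : ℕ} (ha : a ∈ A.freeVars) :
    ∃ r ∈ A.atoms F, a ∈ r.varFinset := by
  induction A with
  | top => exact ha.elim
  | bot => exact ha.elim
  | rel R ts =>
    obtain ⟨i, hi⟩ := Set.mem_iUnion.1 ha
    obtain ⟨r, hr, h⟩ := exists_mem_termAtoms hi
    exact ⟨r, Set.mem_iUnion.2 ⟨i, hr⟩, h⟩
  | neg A ih => exact ih ha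
  | and A B ihA ihB =>
    rcases ha with ha | ha
    · exact (ihA ha).imp fun r h => ⟨.inl h.1, h.2⟩
    · exact (ihB ha).imp fun r h => ⟨.inr h.1, h.2⟩
  | or A B ihA ihB =>
    rcases ha with ha | ha
    · exact (ihA ha).imp fun r h => ⟨.inl h.1, h.2⟩
    · exact (ihB ha).imp fun r h => ⟨.inr h.1, h.2⟩
  | all A ih => exact ih ha
  | ex A ih => exact ih ha

/-- A function symbol outside `F` heads a compound atom or lies inside one. Clearing a formula of
foreign symbols thus amounts to removing its compound atoms. -/
theorem funcs_subset_of_atoms {A : Formula L n} (h : ∀ r ∈ A.atoms F, ∃ x, r = .var x) :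
    A.funcs ⊆ F := by
  induction A with
  | top => exact Set.empty_subset _
  | bot => exact Set.empty_subset _
  | rel R ts =>
    exact Set.iUnion_subset fun i => termFuncs_subset_of_termAtoms fun r hr =>
      h r (Set.mem_iUnion.2 ⟨i, hr⟩)
  | neg A ih => exact ih h
  | and A B ihA ihB =>
    exact Set.union_subset (ihA fun r hr => h r (.inl hr)) (ihB fun r hr => h r (.inr hr))
  | or A B ihA ihB =>
    exact Set.union_subset (ihA fun r hr => h r (.inl hr)) (ihB fun r hr => h r (.inr hr))
  | all A ih => exact ih h
  | ex A ih => exact ih h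

theorem atoms_eq_var_of_funcs_subset {A : Formula L n} (h : A.funcs ⊆ F) {r : L.Term ℕ}
    (hr : r ∈ A.atoms F) : ∃ x, r = .var x := by
  induction A with
  | top => exact hr.elim
  | bot => exact hr.elim
  | rel R ts =>
    obtain ⟨i, hi⟩ := Set.mem_iUnion.1 hr
    have h' : termFuncs (ts i) ⊆ F := (Set.subset_iUnion _ i).trans h
    clear h hr
    generalize ts i = t at hi h'
    induction t with
    | var x =>
      rcases x with x | i
      · exact ⟨x, hi⟩
      · exact hi.elim
    | func f us ih =>
      rw [termFuncs, Set.insert_subset_iff, Set.iUnion_subset_iff] at h'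
      rw [termAtoms_func_mem h'.1] at hi
      obtain ⟨j, hj⟩ := Set.mem_iUnion.1 hi
      exact ih j hj (h'.2 j)
  | neg A ih => exact ih h hr
  | and A B ihA ihB =>
    exact hr.elim (ihA (Set.union_subset_iff.1 h).1) (ihB (Set.union_subset_iff.1 h).2)
  | or A B ihA ihB =>
    exact hr.elim (ihA (Set.union_subset_iff.1 h).1) (ihB (Set.union_subset_iff.1 h).2)
  | all A ih => exact ih h hr
  | ex A ih => exact ih h hr

/-- Enlarging `F` to `F'` may break an `F`-atom into smaller pieces and changes nothing else, so it
suffices to compare the two replacements on each `F`-atom. -/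
theorem gsub_eq_of_subset {A : Formula L n} (hA : A.Adm P F) (hF : F ⊆ F')
    {ψ : L.Term ℕ ⊕ Fin n → L.Term (ℕ ⊕ Fin m)}
    (h : ∀ s ∈ A.atoms F, tsub F' ψ (s.relabel Sum.inl) = ψ (Sum.inl s)) :
    A.gsub F' ψ = A.gsub F ψ := by
  have hl : ∀ {n m : ℕ} {S : Set (L.Term ℕ)} {ψ : L.Term ℕ ⊕ Fin n → L.Term (ℕ ⊕ Fin m)},
      (∀ s ∈ S, tsub F' ψ (s.relabel Sum.inl) = ψ (Sum.inl s)) →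
        ∀ s ∈ S, tsub F' (liftSub ψ) (s.relabel Sum.inl) = liftSub ψ (Sum.inl s) := by
    intro n m S ψ h s hs
    have e : (s.relabel Sum.inl : L.Term (ℕ ⊕ Fin (n + 1))) =
        (s.relabel Sum.inl : L.Term (ℕ ⊕ Fin n)).relabel (Sum.map id Fin.castSucc) := by
      rw [Term.relabel_relabel]; rfl
    rw [e, tsub_liftSub_relabel, h s hs]
    rfl
  have ht : ∀ {n m : ℕ} {t : L.Term (ℕ ⊕ Fin n)}
      {ψ : L.Term ℕ ⊕ Fin n → L.Term (ℕ ⊕ Fin m)}, TermAdm F t →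
      (∀ s ∈ termAtoms F t, tsub F' ψ (s.relabel Sum.inl) = ψ (Sum.inl s)) →
        tsub F' ψ t = tsub F ψ t := by
    intro n m t ψ ht h
    induction ht with
    | var x => rcases x with x | i <;> rfl
    | func f ts hf _ ih =>
      rw [termAtoms_func_mem hf] at h
      rw [tsub_func_mem _ hf, tsub_func_mem _ (hF hf)]
      congr 1
      funext i
      exact ih i fun s hs => h s (Set.mem_iUnion.2 ⟨i, hs⟩)
    | free f ts hf =>
      rw [termAtoms_free hf] at h
      rw [tsub_free _ hf]
      exact h _ rfl
  induction A generalizing m with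
  | top => rfl
  | bot => rfl
  | rel R ts =>
    exact congrArg (rel R) (funext fun i => ht (hA.2 i)
      fun s hs => h s (Set.mem_iUnion.2 ⟨i, hs⟩))
  | neg A ih => exact congrArg neg (ih hA h)
  | and A B ihA ihB =>
    exact congrArg₂ and (ihA hA.1 fun s hs => h s (.inl hs)) (ihB hA.2 fun s hs => h s (.inr hs))
  | or A B ihA ihB =>
    exact congrArg₂ or (ihA hA.1 fun s hs => h s (.inl hs)) (ihB hA.2 fun s hs => h s (.inr hs))
  | all A ih => exact congrArg all (ih hA (hl h))
  | ex A ih => exact congrArg ex (ih hA (hl h))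

/-! ### Abstraction of an atom. -/

/-- Abstracting the atom `r`: its occurrences become a new open slot. -/
noncomputable def abstr (F : Set (Σ l : ℕ, L.Functions l)) (r : L.Term ℕ) (A : Formula L 0) :
    Formula L 1 :=
  A.gsub F (Sum.elim (repl r (.var (Sum.inr 0))) Fin.elim0)

theorem abstr_inst (A : Formula L 0) (r t : L.Term ℕ) :
    (A.abstr F r).inst t = A.gsub F (Sum.elim (repl r (t.relabel Sum.inl)) Fin.elim0) := by
  rw [abstr, Formula.inst, subst_gsub]
  refine gsub_congr (fun s _ => ?_) fun i => i.elim0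
  by_cases hs : s = r
  · subst hs
    simp only [Sum.elim_inl, repl_self]
    rfl
  · simp only [Sum.elim_inl, repl_of_ne hs]
    exact subst_relabel_inl
      (Sum.elim (fun x => .var (Sum.inl x)) fun _ => t.relabel Sum.inl) (fun _ => rfl) s

theorem abstr_inst_self {A : Formula L 0} (hA : A.Adm P F) (r : L.Term ℕ) :
    (A.abstr F r).inst r = A := by
  rw [abstr_inst]
  refine gsub_id hA (fun s _ => ?_) fun i => i.elim0
  by_cases hs : s = r
  · rw [hs]; exact repl_self r _
  · exact repl_of_ne hs _

theorem Adm.abstr {A : Formula L 0} (hA : A.Adm P F) (r : L.Term ℕ) :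
    (A.abstr F r).Adm P F := by
  refine hA.gsub fun x => ?_
  rcases x with s | i
  · by_cases hs : s = r
    · rw [hs, Sum.elim_inl, repl_self]; exact .var _
    · rw [Sum.elim_inl, repl_of_ne hs]; exact TermAdm.relabel_inl F s
  · exact i.elim0

/-- Abstraction erases `r` and creates no atom, because a bound slot is not one; hence the repeated
removal of atoms terminates. -/
theorem mem_atoms_abstr {A : Formula L 0} {r s : L.Term ℕ} (hs : s ∈ (A.abstr F r).atoms F) :
    s ∈ A.atoms F ∧ s ≠ r := by
  rcases mem_atoms_gsub hs with ⟨s', hs', h⟩ | ⟨i, -⟩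
  · by_cases e : s' = r
    · rw [e, Sum.elim_inl, repl_self] at h
      exact h.elim
    · rw [Sum.elim_inl, repl_of_ne e, termAtoms_relabel_inl (isAtom_of_mem_atoms hs')] at h
      obtain rfl : s = s' := h
      exact ⟨hs', e⟩
  · exact i.elim0

theorem freeVars_abstr_subset {A : Formula L 0} (hA : A.Adm P F) (r : L.Term ℕ) :
    (A.abstr F r).freeVars ⊆ A.freeVars := fun _ ha => by
  obtain ⟨s, hs, has⟩ := exists_mem_atoms (F := F) ha
  exact mem_freeVars_of_mem_atoms hA (mem_atoms_abstr hs).1 has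

end

end Formula

/-! ### Structural properties of provability -/

theorem exists_fresh (Γ : Multiset (Formula L 0)) : ∃ z : ℕ, ∀ G ∈ Γ, z ∉ G.freeVars := by
  have h : (⋃ G ∈ {G | G ∈ Γ}, G.freeVars).Finite :=
    Set.Finite.biUnion (Multiset.finite_toSet Γ) fun G _ => G.freeVars_finite
  obtain ⟨z, hz⟩ := h.exists_notMem
  exact ⟨z, fun G hG hzG => hz (Set.mem_biUnion hG hzG)⟩

open Classical in
theorem gsub_update {P : Set (PredSymbol L)} {F : Set (Σ l : ℕ, L.Functions l)} {G : Formula L 0}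
    (hG : G.Adm P F) {a : ℕ} (ha : a ∉ G.freeVars) (ψ : L.Term ℕ ⊕ Fin 0 → L.Term (ℕ ⊕ Fin 0))
    (t : L.Term (ℕ ⊕ Fin 0)) :
    G.gsub F (Function.update ψ (Sum.inl (.var a)) t) = G.gsub F ψ := by
  refine Formula.gsub_congr (fun s hs => Function.update_of_ne ?_ _ _) fun i => i.elim0
  intro e
  rw [Sum.inl.inj e] at hs
  exact ha (Formula.mem_freeVars_of_mem_atoms hG hs (by simp))

open Classical in
-- For a premise with eigenvariable `a`, the replacement is redirected at `a` to a new variable `z`;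
-- the premise then turns into the instance at `z` of the replaced body.
theorem gsub_update_inst {P : Set (PredSymbol L)} {F : Set (Σ l : ℕ, L.Functions l)}
    {A : Formula L 1} (hA : A.Adm P F) {a : ℕ} (ha : a ∉ A.freeVars)
    (ψ : L.Term ℕ ⊕ Fin 0 → L.Term (ℕ ⊕ Fin 0)) (z : ℕ) :
    (A.inst (.var a)).gsub F (Function.update ψ (Sum.inl (.var a)) (.var (Sum.inl z))) =
      (A.gsub F (liftSub ψ)).inst (.var z) := by
  -- `A` has an open slot, so the lemma is applied to `∀x.A` and the quantifier is stripped from the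
  -- equation.
  have h := gsub_update (G := .all A) hA ha ψ (.var (Sum.inl z))
  rw [Formula.gsub, Formula.gsub] at h
  injection h with _ h
  rw [Formula.gsub_inst hA, h, Term.relabel, tsub, Function.update_self]
  rfl

open Classical in
/-- Provability is preserved by replacing atoms relative to a set of function symbols whose
complement is never applied to bound variables, and by weakening on the left. -/
theorem Provable.gsub {c : Bool} {P : Set (PredSymbol L)} {F : Set (Σ l : ℕ, L.Functions l)}
    {Γ Δ : Multiset (Formula L 0)} (h : Provable c Γ Δ) (hΓ : ∀ G ∈ Γ, G.Adm P F)
    (hΔ : ∀ G ∈ Δ, G.Adm P F) (ψ : L.Term ℕ ⊕ Fin 0 → L.Term (ℕ ⊕ Fin 0))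
    (Θ : Multiset (Formula L 0)) :
    Provable c (Γ.map (fun G => G.gsub F ψ) + Θ) (Δ.map fun G => G.gsub F ψ) := by
  have hupd : ∀ {Γ : Multiset (Formula L 0)}, (∀ G ∈ Γ, G.Adm P F) → ∀ {a : ℕ},
      (∀ G ∈ Γ, a ∉ G.freeVars) → ∀ (ψ : L.Term ℕ ⊕ Fin 0 → L.Term (ℕ ⊕ Fin 0)) (t),
      Γ.map (fun G => G.gsub F (Function.update ψ (Sum.inl (.var a)) t)) =
        Γ.map fun G => G.gsub F ψ := fun h₁ _ h₂ ψ t =>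
    Multiset.map_congr rfl fun G hG => gsub_update (h₁ G hG) (h₂ G hG) ψ t
  induction h generalizing ψ Θ with
  | ax Γ C =>
    rw [Multiset.map_cons, Multiset.cons_add, Multiset.map_singleton]
    exact .ax _ _
  | topAx hc Γ => exact .topAx hc _
  | botAx hc Γ =>
    rw [Multiset.map_cons, Multiset.cons_add]
    exact .botAx hc _
  | negLeft _ ih =>
    simp only [Multiset.forall_mem_cons, Multiset.map_cons, Multiset.cons_add,
      Multiset.mem_singleton, forall_eq, Multiset.map_singleton, Multiset.map_zero] at *
    exact .negLeft (ih hΓ.2 hΓ.1 ψ Θ)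
  | negRight _ ih =>
    simp only [Multiset.forall_mem_cons, Multiset.map_cons, Multiset.cons_add,
      Multiset.mem_singleton, forall_eq, Multiset.map_singleton, Multiset.map_zero] at *
    exact .negRight (ih ⟨hΔ, hΓ⟩ (by simp) ψ Θ)
  | andRight _ _ ih₁ ih₂ =>
    simp only [Multiset.mem_singleton, forall_eq, Multiset.map_singleton, Multiset.mem_add,
      Multiset.map_add] at *
    -- Antecedents add up in this rule, so `Θ` is put into one premise only.
    have h := Provable.andRight (ih₁ (fun G hG => hΓ G (.inl hG)) hΔ.1 ψ Θ)
      (ih₂ (fun G hG => hΓ G (.inr hG)) hΔ.2 ψ 0)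
    rw [add_zero, add_right_comm] at h
    exact h
  | andLeft₁ _ ih =>
    simp only [Multiset.forall_mem_cons, Multiset.map_cons, Multiset.cons_add,
      Multiset.map_replicate] at *
    exact .andLeft₁ (ih ⟨hΓ.1.1, hΓ.2⟩ hΔ ψ Θ)
  | andLeft₂ _ ih =>
    simp only [Multiset.forall_mem_cons, Multiset.map_cons, Multiset.cons_add,
      Multiset.map_replicate] at *
    exact .andLeft₂ (ih ⟨hΓ.1.2, hΓ.2⟩ hΔ ψ Θ)
  | orLeft _ _ ih₁ ih₂ =>
    simp only [Multiset.forall_mem_cons, Multiset.map_cons, Multiset.cons_add,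
      Multiset.map_replicate, Multiset.map_add, Multiset.mem_add, Multiset.replicate_add] at *
    have h := Provable.orLeft
      (ih₁ ⟨hΓ.1.1, fun G hG => hΓ.2 G (.inl hG)⟩ (fun G hG => hΔ G (.inl hG)) ψ Θ)
      (ih₂ ⟨hΓ.1.2, fun G hG => hΓ.2 G (.inr hG)⟩ (fun G hG => hΔ G (.inr hG)) ψ 0)
    rw [add_zero, add_right_comm, Multiset.replicate_add] at h
    exact h
  | orRight₁ _ ih =>
    simp only [Multiset.mem_singleton, forall_eq, Multiset.map_singleton] at *
    exact .orRight₁ (ih hΓ hΔ.1 ψ Θ)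
  | orRight₂ _ ih =>
    simp only [Multiset.mem_singleton, forall_eq, Multiset.map_singleton] at *
    exact .orRight₂ (ih hΓ hΔ.2 ψ Θ)
  | @allRight Γ A a ha haA _ ih =>
    simp only [Multiset.mem_singleton, forall_eq, Multiset.map_singleton] at *
    -- `Θ` and the values of `ψ` may contain `a`, so the eigenvariable is changed to a new `z`.
    obtain ⟨z, hz⟩ := exists_fresh
      (.all (A.gsub F (liftSub ψ)) ::ₘ (Γ.map (fun G => G.gsub F ψ) + Θ))
    rw [Multiset.forall_mem_cons] at hz
    refine .allRight z hz.2 hz.1 ?_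
    have h := ih hΓ (Formula.Adm.inst hΔ _)
      (Function.update ψ (Sum.inl (.var a)) (.var (Sum.inl z))) Θ
    rwa [hupd hΓ ha, gsub_update_inst hΔ haA] at h
  | @allLeft Γ A C k t _ ih =>
    simp only [Multiset.forall_mem_cons, Multiset.map_cons, Multiset.cons_add,
      Multiset.map_replicate] at *
    have h := ih ⟨Formula.Adm.inst hΓ.1 _, hΓ.2⟩ hΔ ψ Θ
    rw [Formula.gsub_inst hΓ.1] at h
    exact .allLeft _ h
  | @exRight Γ A t _ ih =>
    simp only [Multiset.mem_singleton, forall_eq, Multiset.map_singleton] at *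
    have h := ih hΓ (Formula.Adm.inst hΔ _) ψ Θ
    rw [Formula.gsub_inst hΔ] at h
    exact .exRight _ h
  | @exLeft Γ A C k a ha haA haC _ ih =>
    simp only [Multiset.forall_mem_cons] at hΓ ih
    obtain ⟨z, hz⟩ := exists_fresh
      (C.gsub F ψ ::ₘ .ex (A.gsub F (liftSub ψ)) ::ₘ (Γ.map (fun G => G.gsub F ψ) + Θ))
    rw [Multiset.forall_mem_cons, Multiset.forall_mem_cons] at hz
    rw [Multiset.map_cons, Multiset.cons_add, Multiset.map_replicate]
    refine .exLeft z hz.2.2 hz.2.1 hz.1 ?_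
    have h := ih ⟨Formula.Adm.inst hΓ.1 _, hΓ.2⟩ hΔ
      (Function.update ψ (Sum.inl (.var a)) (.var (Sum.inl z))) Θ
    rw [Multiset.map_cons, hupd hΓ.2 ha, gsub_update_inst hΓ.1 haA, hupd hΔ, Multiset.cons_add,
      Multiset.map_replicate] at h
    · exact h
    · intro G hG
      rwa [Multiset.eq_of_mem_replicate hG]
  | @contrRight Γ C s hs _ ih =>
    have h := ih hΓ (fun G hG => hΔ G (by
      rw [Multiset.eq_of_mem_replicate hG]
      exact Multiset.mem_replicate.2 ⟨by omega, rfl⟩)) ψ Θ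
    rw [Multiset.map_replicate] at h ⊢
    exact .contrRight hs h
  | contrLeft _ ih =>
    simp only [Multiset.forall_mem_cons, Multiset.map_cons, Multiset.cons_add,
      Multiset.map_replicate] at *
    exact .contrLeft (ih ⟨hΓ.1, hΓ⟩ hΔ ψ Θ)

namespace Provable

variable {c : Bool} {Γ Δ Θ : Multiset (Formula L 0)}

/-- Weakening on the left is `Provable.gsub` for the identical replacement, with all function
symbols allowed. -/
theorem add_right (h : Provable c Γ Δ) (Θ : Multiset (Formula L 0)) : Provable c (Γ + Θ) Δ := by
  have hadm : ∀ G : Formula L 0, G.Adm Set.univ Set.univ := fun G =>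
    Formula.adm_of_subset (Set.subset_univ _) (Set.subset_univ _)
  have hid : ∀ G : Formula L 0, G.gsub Set.univ
      (Sum.elim (fun s => s.relabel Sum.inl) fun i => .var (Sum.inr i)) = G := fun G =>
    Formula.gsub_id (hadm G) (fun _ _ => rfl) fun _ => rfl
  have h' := h.gsub (fun G _ => hadm G) (fun G _ => hadm G)
    (Sum.elim (fun s => s.relabel Sum.inl) fun i => .var (Sum.inr i)) Θ
  simpa only [hid, Multiset.map_id'] using h'

theorem mono (h : Provable c Γ Δ) {Γ' : Multiset (Formula L 0)} (hΓ : Γ ≤ Γ') :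
    Provable c Γ' Δ := by
  obtain ⟨Θ, rfl⟩ := Multiset.le_iff_exists_add.1 hΓ
  exact h.add_right Θ

theorem cons_left (h : Provable c Γ Δ) (A : Formula L 0) : Provable c (A ::ₘ Γ) Δ :=
  h.mono (Multiset.le_cons_self _ _)

theorem contract_add {C : Formula L 0} {k : ℕ} (Θ : Multiset (Formula L 0))
    (h : Provable c (Θ + (Θ + Γ)) (Multiset.replicate k C)) :
    Provable c (Θ + Γ) (Multiset.replicate k C) := by
  induction Θ using Multiset.induction_on generalizing Γ with
  | empty => simpa using h
  | cons A Θ ih =>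
    have h₁ : Provable c (Θ + (Θ + (A ::ₘ A ::ₘ Γ))) (Multiset.replicate k C) := by
      simpa only [Multiset.cons_add, Multiset.add_cons] using h
    have h₂ := ih h₁
    simp only [Multiset.add_cons] at h₂
    rw [Multiset.cons_add]
    exact h₂.contrLeft

theorem squash {C : Formula L 0} {k : ℕ} (h : Provable c Γ (Multiset.replicate (k + 1) C)) :
    Provable c Γ {C} := by
  induction k with
  | zero => exact h
  | succ k ih => exact ih (.contrRight (by omega) h)

theorem exists_eq_replicate (h : Provable c Γ Δ) : ∃ k C, Δ = Multiset.replicate k C := by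
  cases h with
  | negLeft => exact ⟨0, .top, rfl⟩
  | botAx => exact ⟨0, .top, rfl⟩
  | ax => exact ⟨1, _, rfl⟩
  | topAx => exact ⟨1, _, rfl⟩
  | negRight => exact ⟨1, _, rfl⟩
  | andRight => exact ⟨1, _, rfl⟩
  | orRight₁ => exact ⟨1, _, rfl⟩
  | orRight₂ => exact ⟨1, _, rfl⟩
  | allRight => exact ⟨1, _, rfl⟩
  | exRight => exact ⟨1, _, rfl⟩
  | andLeft₁ => exact ⟨_, _, rfl⟩
  | andLeft₂ => exact ⟨_, _, rfl⟩
  | orLeft => exact ⟨_, _, rfl⟩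
  | allLeft => exact ⟨_, _, rfl⟩
  | exLeft => exact ⟨_, _, rfl⟩
  | contrRight => exact ⟨_, _, rfl⟩
  | contrLeft => exact ⟨_, _, rfl⟩

end Provable

theorem Formula.gsub_repl_of_notMem {P : Set (PredSymbol L)} {F : Set (Σ l : ℕ, L.Functions l)}
    {G : Formula L 0} (hG : G.Adm P F) {r : L.Term ℕ} (hr : r ∉ G.atoms F)
    (t : L.Term (ℕ ⊕ Fin 0)) :
    G.gsub F (Sum.elim (repl r t) Fin.elim0) = G :=
  Formula.gsub_id hG (fun s hs => repl_of_ne (fun e : s = r => hr (e ▸ hs)) t) fun i => i.elim0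

/-! ### Removing atoms from an interpolant -/

/-- `I` interpolates between the antecedent `Γ₁` and the sequent `Γ₂ → Δ`. -/
structure IsInterpolant (c : Bool) (P : Set (PredSymbol L)) (F : Set (Σ l : ℕ, L.Functions l))
    (Γ₁ Γ₂ Δ : Multiset (Formula L 0)) (I : Formula L 0) : Prop where
  adm : I.Adm P F
  left : Provable c Γ₁ {I}
  right : Provable c (I ::ₘ Γ₂) Δ

section

variable {c : Bool} {P₁ P₂ : Set (PredSymbol L)} {F₁ F₂ : Set (Σ l : ℕ, L.Functions l)}
  {Γ₁ Γ₂ Δ : Multiset (Formula L 0)} {I : Formula L 0}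

/-- If `r` is an `F₁`-atom missing from `Γ₁`, replacing it by a fresh `z` in the proof of `Γ₁ → I`
leaves `Γ₁` alone, so `∀` can be introduced over `z`; on the other side, instantiating at `r` gives
`I` back. The case of `∃` is dual. The replacement is made relative to `F₁` or `F₂`, where an `F₁ ∩
F₂`-atom of `I` may decompose and expose `r` inside it. By `hmax` no atom other than `r` contains
`r`, so the result is the abstraction of `I` instantiated at `z`. -/
theorem IsInterpolant.exists_remove (hI : IsInterpolant c (P₁ ∩ P₂) (F₁ ∩ F₂) Γ₁ Γ₂ Δ I)
    (h₁ : ∀ G ∈ Γ₁, G.Adm P₁ F₁) (h₂ : ∀ G ∈ Γ₂, G.Adm P₂ F₂) (hΔ : ∀ G ∈ Δ, G.Adm P₂ F₂)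
    {r : L.Term ℕ}
    (hr : (IsAtom F₁ r ∧ ∀ G ∈ Γ₁, r ∉ G.atoms F₁) ∨
      (IsAtom F₂ r ∧ (∀ G ∈ Γ₂, r ∉ G.atoms F₂) ∧ ∀ G ∈ Δ, r ∉ G.atoms F₂))
    (hmax : ∀ s ∈ I.atoms (F₁ ∩ F₂), s = r ∨ ¬ IsSubterm r s) :
    ∃ J, IsInterpolant c (P₁ ∩ P₂) (F₁ ∩ F₂) Γ₁ Γ₂ Δ J ∧
      J.atoms (F₁ ∩ F₂) ⊆ I.atoms (F₁ ∩ F₂) \ {r} := by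
  obtain ⟨k, C, rfl⟩ := hI.right.exists_eq_replicate
  obtain ⟨z, hz⟩ := exists_fresh (C ::ₘ I ::ₘ (Γ₁ + Γ₂))
  simp only [Multiset.forall_mem_cons, Multiset.mem_add] at hz
  obtain ⟨hzC, hzI, hzΓ⟩ := hz
  have hzJ : z ∉ (I.abstr (F₁ ∩ F₂) r).freeVars := fun h =>
    hzI (Formula.freeVars_abstr_subset hI.adm r h)
  have key : ∀ {F}, F₁ ∩ F₂ ⊆ F → IsAtom F r →
      I.gsub F (Sum.elim (repl r (.var (Sum.inl z))) Fin.elim0) =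
        (I.abstr (F₁ ∩ F₂) r).inst (.var z) := by
    intro F hF hrF
    rw [Formula.abstr_inst]
    refine Formula.gsub_eq_of_subset hI.adm hF fun s hs => ?_
    rcases hmax s hs with rfl | hs
    · exact (tsub_repl_relabel_inl hrF _).trans (repl_self s _).symm
    · refine (tsub_repl_of_not_isSubterm hs _).trans (repl_of_ne ?_ _).symm
      rintro rfl
      exact hs (by cases s with | var x => rfl | func f ts => exact .inl rfl)
  have hself := Formula.abstr_inst_self hI.adm r
  rcases hr with ⟨hr, hr₁⟩ | ⟨hr, hr₂, hrΔ⟩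
  · refine ⟨.all (I.abstr (F₁ ∩ F₂) r), ⟨hI.adm.abstr r, ?_, ?_⟩,
      fun s hs => Formula.mem_atoms_abstr hs⟩
    · refine .allRight z (fun G hG => hzΓ G (.inl hG)) hzJ ?_
      have h := hI.left.gsub h₁
        (by simpa using hI.adm.mono Set.inter_subset_left Set.inter_subset_left)
        (Sum.elim (repl r (.var (Sum.inl z))) Fin.elim0) 0
      rw [add_zero, Multiset.map_singleton, key Set.inter_subset_left hr, Multiset.map_congr rfl
        fun G hG => Formula.gsub_repl_of_notMem (h₁ G hG) (hr₁ G hG) _, Multiset.map_id'] at h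
      exact h
    · exact .allLeft r (by rw [hself]; exact hI.right)
  · refine ⟨.ex (I.abstr (F₁ ∩ F₂) r), ⟨hI.adm.abstr r, ?_, ?_⟩,
      fun s hs => Formula.mem_atoms_abstr hs⟩
    · exact .exRight r (by rw [hself]; exact hI.left)
    · refine .exLeft z (fun G hG => hzΓ G (.inr hG)) hzJ hzC ?_
      have h := hI.right.gsub (Multiset.forall_mem_cons.2
        ⟨hI.adm.mono Set.inter_subset_right Set.inter_subset_right, h₂⟩) hΔ
        (Sum.elim (repl r (.var (Sum.inl z))) Fin.elim0) 0
      rw [add_zero, Multiset.map_cons, key Set.inter_subset_right hr, Multiset.map_congr rfl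
        fun G hG => Formula.gsub_repl_of_notMem (h₂ G hG) (hr₂ G hG) _, Multiset.map_id',
        Multiset.map_congr rfl
        fun G hG => Formula.gsub_repl_of_notMem (hΔ G hG) (hrΔ G hG) _, Multiset.map_id'] at h
      exact h

/-- The largest critical atom goes first. By `hup`, an atom of `I` that contains it is critical too,
hence not larger, hence equal to it; this is the maximality that a single removal needs. The number
of critical atoms drops each time. -/
theorem IsInterpolant.exists_remove_all (hI : IsInterpolant c (P₁ ∩ P₂) (F₁ ∩ F₂) Γ₁ Γ₂ Δ I)
    (h₁ : ∀ G ∈ Γ₁, G.Adm P₁ F₁) (h₂ : ∀ G ∈ Γ₂, G.Adm P₂ F₂) (hΔ : ∀ G ∈ Δ, G.Adm P₂ F₂)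
    (Crit : L.Term ℕ → Prop)
    (hcrit : ∀ r, IsAtom (F₁ ∩ F₂) r → Crit r →
      (IsAtom F₁ r ∧ ∀ G ∈ Γ₁, r ∉ G.atoms F₁) ∨
      (IsAtom F₂ r ∧ (∀ G ∈ Γ₂, r ∉ G.atoms F₂) ∧ ∀ G ∈ Δ, r ∉ G.atoms F₂))
    (hup : ∀ r s, Crit r → IsSubterm r s → Crit s) :
    ∃ J, IsInterpolant c (P₁ ∩ P₂) (F₁ ∩ F₂) Γ₁ Γ₂ Δ J ∧
      ∀ s ∈ J.atoms (F₁ ∩ F₂), ¬ Crit s := by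
  have hfin : ∀ J : Formula L 0, {s ∈ J.atoms (F₁ ∩ F₂) | Crit s}.Finite := fun J =>
    J.atoms_finite.subset fun _ h => h.1
  induction hN : {s ∈ I.atoms (F₁ ∩ F₂) | Crit s}.ncard using Nat.strong_induction_on
    generalizing I with
  | _ N ih =>
    subst hN
    by_cases hne : {s ∈ I.atoms (F₁ ∩ F₂) | Crit s}.Nonempty
    · obtain ⟨r, hr, hmax⟩ := Set.exists_max_image _ termSize (hfin I) hne
      obtain ⟨J, hJ, hsub⟩ := hI.exists_remove h₁ h₂ hΔ
        (hcrit r (Formula.isAtom_of_mem_atoms hr.1) hr.2) fun s hs => by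
          by_cases hrs : IsSubterm r s
          · have := hmax s ⟨hs, hup r s hr.2 hrs⟩
            rcases hrs.eq_or_termSize_lt with h | h
            · exact .inl h.symm
            · omega
          · exact .inr hrs
      refine ih _ (Set.ncard_lt_ncard ?_ (hfin I)) hJ rfl
      refine ⟨fun s hs => ⟨(hsub hs.1).1, hs.2⟩, fun h => ?_⟩
      exact (hsub (h hr).1).2 rfl
    · exact ⟨I, hI, fun s hs hc => hne ⟨s, hs, hc⟩⟩

/-- An interpolant may be chosen without a variable that occurs on one side at most. -/
theorem IsInterpolant.exists_notMem_freeVars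
    (hI : IsInterpolant c (P₁ ∩ P₂) (F₁ ∩ F₂) Γ₁ Γ₂ Δ I)
    (h₁ : ∀ G ∈ Γ₁, G.Adm P₁ F₁) (h₂ : ∀ G ∈ Γ₂, G.Adm P₂ F₂) (hΔ : ∀ G ∈ Δ, G.Adm P₂ F₂)
    {a : ℕ}
    (ha : ((∀ G ∈ Γ₁, a ∉ G.freeVars) ∧
        ∀ G ∈ Γ₂ + Δ, ∀ r ∈ G.atoms F₂, a ∈ r.varFinset → r = .var a) ∨
      ((∀ G ∈ Γ₂ + Δ, a ∉ G.freeVars) ∧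
        ∀ G ∈ Γ₁, ∀ r ∈ G.atoms F₁, a ∈ r.varFinset → r = .var a)) :
    ∃ J, IsInterpolant c (P₁ ∩ P₂) (F₁ ∩ F₂) Γ₁ Γ₂ Δ J ∧ a ∉ J.freeVars := by
  simp only [Multiset.mem_add] at ha
  have hatom : ∀ r, IsAtom (F₁ ∩ F₂) r → IsAtom F₁ r ∨ IsAtom F₂ r := fun r hr => by
    cases r with
    | var x => exact .inl trivial
    | func f ts => exact not_and_or.1 hr
  have hcrit : ∀ r, IsAtom (F₁ ∩ F₂) r → a ∈ r.varFinset →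
      (IsAtom F₁ r ∧ ∀ G ∈ Γ₁, r ∉ G.atoms F₁) ∨
      (IsAtom F₂ r ∧ (∀ G ∈ Γ₂, r ∉ G.atoms F₂) ∧ ∀ G ∈ Δ, r ∉ G.atoms F₂) := by
    intro r hr har
    rcases ha with ⟨ha₁, ha₂⟩ | ⟨ha₂, ha₁⟩
    · have hΓ₁ : ∀ G ∈ Γ₁, r ∉ G.atoms F₁ := fun G hG hrG =>
        ha₁ G hG (Formula.mem_freeVars_of_mem_atoms (h₁ G hG) hrG har)
      by_cases hr₁ : IsAtom F₁ r
      · exact .inl ⟨hr₁, hΓ₁⟩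
      -- Variables are atoms for every set of function symbols, so `r` is compound, whereas `a`
      -- occurs in the `F₂`-atoms of `Γ₂` and `Δ` only as the variable itself.
      · have hne : r ≠ .var a := by rintro rfl; exact hr₁ trivial
        exact .inr ⟨(hatom r hr).resolve_left hr₁,
          fun G hG hrG => hne (ha₂ G (.inl hG) r hrG har),
          fun G hG hrG => hne (ha₂ G (.inr hG) r hrG har)⟩
    · have hΓ₂ : ∀ G, (G ∈ Γ₂ ∨ G ∈ Δ) → r ∉ G.atoms F₂ := fun G hG hrG =>
        ha₂ G hG (Formula.mem_freeVars_of_mem_atoms (hG.elim (h₂ G) (hΔ G)) hrG har)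
      by_cases hr₂ : IsAtom F₂ r
      · exact .inr ⟨hr₂, fun G hG => hΓ₂ G (.inl hG), fun G hG => hΓ₂ G (.inr hG)⟩
      · have hne : r ≠ .var a := by rintro rfl; exact hr₂ trivial
        exact .inl ⟨(hatom r hr).resolve_right hr₂,
          fun G hG hrG => hne (ha₁ G hG r hrG har)⟩
  obtain ⟨J, hJ, h⟩ := hI.exists_remove_all h₁ h₂ hΔ (fun r => a ∈ r.varFinset)
    hcrit fun r s hr hrs => hrs.varFinset_subset hr
  refine ⟨J, hJ, fun haJ => ?_⟩
  obtain ⟨r, hr, har⟩ := Formula.exists_mem_atoms (F := F₁ ∩ F₂) haJ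
  exact h r hr har

end

/-! ### Interpolation for partitioned antecedents -/

theorem forall_mem_singleton {α : Type*} {p : α → Prop} {X : α} :
    (∀ Y ∈ ({X} : Multiset α), p Y) ↔ p X := by
  simp

theorem cons_eq_add {α : Type*} {X : α} {Γ Γ₁ Γ₂ : Multiset α} (h : X ::ₘ Γ = Γ₁ + Γ₂) :
    (∃ Γ', Γ₁ = X ::ₘ Γ' ∧ Γ = Γ' + Γ₂) ∨ ∃ Γ', Γ₂ = X ::ₘ Γ' ∧ Γ = Γ₁ + Γ' := by
  have hX : X ∈ Γ₁ + Γ₂ := h ▸ Multiset.mem_cons_self X Γ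
  rcases Multiset.mem_add.1 hX with hX | hX
  · obtain ⟨Γ', rfl⟩ := Multiset.exists_cons_of_mem hX
    rw [Multiset.cons_add, Multiset.cons_inj_right] at h
    exact .inl ⟨Γ', rfl, h⟩
  · obtain ⟨Γ', rfl⟩ := Multiset.exists_cons_of_mem hX
    rw [Multiset.add_cons, Multiset.cons_inj_right] at h
    exact .inr ⟨Γ', rfl, h⟩

/-- Used for rules with two premises: the partition of the conclusion's antecedent induces one on
each premise. -/
theorem add_eq_add_refine {α : Type*} {Γ Γ' Γ₁ Γ₂ : Multiset α} (h : Γ + Γ' = Γ₁ + Γ₂) :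
    ∃ a b c d, Γ = a + b ∧ Γ' = c + d ∧ Γ₁ = a + c ∧ Γ₂ = b + d := by
  induction Γ using Multiset.induction_on generalizing Γ₁ Γ₂ with
  | empty => exact ⟨0, 0, Γ₁, Γ₂, by simp, by simpa using h, by simp, by simp⟩
  | cons X Γ ih =>
    rw [Multiset.cons_add] at h
    rcases cons_eq_add h with ⟨Δ, rfl, e⟩ | ⟨Δ, rfl, e⟩
    · obtain ⟨a, b, c, d, rfl, rfl, rfl, rfl⟩ := ih e
      exact ⟨X ::ₘ a, b, c, d, by simp, rfl, by simp, rfl⟩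
    · obtain ⟨a, b, c, d, rfl, rfl, rfl, rfl⟩ := ih e
      exact ⟨a, X ::ₘ b, c, d, by simp, rfl, rfl, by simp⟩

/-- The variable `a` enters only through the slot of `A`, which lies in no atom, so no larger atom
can contain it. -/
theorem eq_var_of_mem_atoms_inst {P : Set (PredSymbol L)} {F : Set (Σ l : ℕ, L.Functions l)}
    {A : Formula L 1} (hA : A.Adm P F) {a : ℕ} (ha : a ∉ A.freeVars) {r : L.Term ℕ}
    (hr : r ∈ (A.inst (.var a)).atoms F) (har : a ∈ r.varFinset) : r = .var a :=
  (Formula.mem_atoms_inst_var hA hr).resolve_left fun h =>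
    ha (Formula.mem_freeVars_of_mem_atoms hA h har)

/-- Admissibility does not restrict the free terms of `I`; they are cleared away after the
induction. Only eigenvariables must go at once. The sets vary in the induction because negation on
the left exchanges the two sides. -/
theorem Provable.exists_isInterpolant {c : Bool} {Γ Δ : Multiset (Formula L 0)}
    (h : Provable c Γ Δ) {P₁ P₂ : Set (PredSymbol L)} {F₁ F₂ : Set (Σ l : ℕ, L.Functions l)}
    {Γ₁ Γ₂ : Multiset (Formula L 0)} {T : Formula L 0} (hT : T.Adm (P₁ ∩ P₂) (F₁ ∩ F₂))
    (hT' : ∀ Θ, Provable c Θ {T}) (hΓ : Γ = Γ₁ + Γ₂) (h₁ : ∀ G ∈ Γ₁, G.Adm P₁ F₁)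
    (h₂ : ∀ G ∈ Γ₂, G.Adm P₂ F₂) (hΔ : ∀ G ∈ Δ, G.Adm P₂ F₂) :
    ∃ I, IsInterpolant c (P₁ ∩ P₂) (F₁ ∩ F₂) Γ₁ Γ₂ Δ I := by
  induction h generalizing P₁ P₂ F₁ F₂ Γ₁ Γ₂ with
  | ax Γ C =>
    rw [forall_mem_singleton] at hΔ
    rcases cons_eq_add hΓ with ⟨Γ₁, rfl, rfl⟩ | ⟨Γ₂, rfl, rfl⟩
    · rw [Multiset.forall_mem_cons] at h₁
      exact ⟨C, h₁.1.inter hΔ, .ax _ _, .ax _ _⟩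
    · exact ⟨T, hT, hT' _, Provable.cons_left (.ax _ _) _⟩
  | topAx hc Γ => exact ⟨T, hT, hT' _, .topAx hc _⟩
  | botAx hc Γ =>
    rcases cons_eq_add hΓ with ⟨Γ₁, rfl, rfl⟩ | ⟨Γ₂, rfl, rfl⟩
    · exact ⟨.neg T, hT, .negRight (Provable.cons_left (.botAx hc _) _), .negLeft (hT' _)⟩
    · exact ⟨T, hT, hT' _, Provable.cons_left (.botAx hc _) _⟩
  | @negLeft Γ A _ ih =>
    rcases cons_eq_add hΓ with ⟨Γ₁, rfl, rfl⟩ | ⟨Γ₂, rfl, rfl⟩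
    · rw [Multiset.forall_mem_cons] at h₁
      -- The succedent `A` of the premise belongs to the first side, so the sides are exchanged: `Γ₂
      -- → I` and `I, Γ₁ → A`. The negation of `I` then interpolates.
      obtain ⟨I, hI⟩ := ih (P₁ := P₂) (P₂ := P₁) (F₁ := F₂) (F₂ := F₁)
        (by rwa [Set.inter_comm P₂, Set.inter_comm F₂]) (add_comm _ _) h₂ h₁.2
        (forall_mem_singleton.2 h₁.1)
      rw [Set.inter_comm P₂, Set.inter_comm F₂] at hI
      refine ⟨.neg I, hI.adm, .negRight ?_, .negLeft hI.left⟩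
      rw [Multiset.cons_swap]
      exact .negLeft hI.right
    · rw [Multiset.forall_mem_cons] at h₂
      obtain ⟨I, hI⟩ := ih hT rfl h₁ h₂.2 (forall_mem_singleton.2 h₂.1)
      refine ⟨I, hI.adm, hI.left, ?_⟩
      rw [Multiset.cons_swap]
      exact .negLeft hI.right
  | @negRight Γ A _ ih =>
    rw [forall_mem_singleton] at hΔ
    obtain ⟨I, hI⟩ := ih (Γ₂ := A ::ₘ Γ₂) hT (by rw [hΓ, Multiset.add_cons]) h₁
      (Multiset.forall_mem_cons.2 ⟨hΔ, h₂⟩) (by simp)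
    refine ⟨I, hI.adm, hI.left, .negRight ?_⟩
    rw [Multiset.cons_swap]
    exact hI.right
  | andRight _ _ ih ih' =>
    rw [forall_mem_singleton] at hΔ
    obtain ⟨a, b, d, e, rfl, rfl, rfl, rfl⟩ := add_eq_add_refine hΓ
    simp only [Multiset.mem_add] at h₁ h₂
    obtain ⟨I, hI⟩ := ih hT rfl (fun G hG => h₁ G (.inl hG)) (fun G hG => h₂ G (.inl hG))
      (forall_mem_singleton.2 hΔ.1)
    obtain ⟨J, hJ⟩ := ih' hT rfl (fun G hG => h₁ G (.inr hG)) (fun G hG => h₂ G (.inr hG))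
      (forall_mem_singleton.2 hΔ.2)
    refine ⟨.and I J, ⟨hI.adm, hJ.adm⟩, .andRight hI.left hJ.left, ?_⟩
    have hI' := Provable.andLeft₁ (B := J) (k := 1) hI.right
    have hJ' := Provable.andLeft₂ (B := I) (k := 1) hJ.right
    have := Provable.andRight hI' hJ'
    rw [Multiset.cons_add, Multiset.add_cons] at this
    exact .contrLeft (k := 1) this
  | @andLeft₁ Γ A B C k _ ih =>
    rcases cons_eq_add hΓ with ⟨Γ₁, rfl, rfl⟩ | ⟨Γ₂, rfl, rfl⟩
    · rw [Multiset.forall_mem_cons] at h₁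
      obtain ⟨I, hI⟩ := ih (Γ₁ := A ::ₘ Γ₁) hT (by simp)
        (Multiset.forall_mem_cons.2 ⟨h₁.1.1, h₁.2⟩) h₂ hΔ
      exact ⟨I, hI.adm, .andLeft₁ (k := 1) hI.left, hI.right⟩
    · rw [Multiset.forall_mem_cons] at h₂
      obtain ⟨I, hI⟩ := ih (Γ₂ := A ::ₘ Γ₂) hT (by simp) h₁
        (Multiset.forall_mem_cons.2 ⟨h₂.1.1, h₂.2⟩) hΔ
      refine ⟨I, hI.adm, hI.left, ?_⟩
      rw [Multiset.cons_swap]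
      exact .andLeft₁ (by rw [Multiset.cons_swap]; exact hI.right)
  | @andLeft₂ Γ A B C k _ ih =>
    rcases cons_eq_add hΓ with ⟨Γ₁, rfl, rfl⟩ | ⟨Γ₂, rfl, rfl⟩
    · rw [Multiset.forall_mem_cons] at h₁
      obtain ⟨I, hI⟩ := ih (Γ₁ := A ::ₘ Γ₁) hT (by simp)
        (Multiset.forall_mem_cons.2 ⟨h₁.1.2, h₁.2⟩) h₂ hΔ
      exact ⟨I, hI.adm, .andLeft₂ (k := 1) hI.left, hI.right⟩
    · rw [Multiset.forall_mem_cons] at h₂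
      obtain ⟨I, hI⟩ := ih (Γ₂ := A ::ₘ Γ₂) hT (by simp) h₁
        (Multiset.forall_mem_cons.2 ⟨h₂.1.2, h₂.2⟩) hΔ
      refine ⟨I, hI.adm, hI.left, ?_⟩
      rw [Multiset.cons_swap]
      exact .andLeft₂ (by rw [Multiset.cons_swap]; exact hI.right)
  | @orLeft Γ Γ' A B C k l _ _ ih ih' =>
    simp only [Multiset.replicate_add, Multiset.mem_add] at hΔ
    rcases cons_eq_add hΓ with ⟨Γ₁, rfl, he⟩ | ⟨Γ₂, rfl, he⟩ <;>
    obtain ⟨a, b, d, e, rfl, rfl, rfl, rfl⟩ := add_eq_add_refine he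
    · simp only [Multiset.forall_mem_cons, Multiset.mem_add] at h₁ h₂
      obtain ⟨I, hI⟩ := ih (Γ₁ := A ::ₘ a) (Γ₂ := b) hT (by simp)
        (Multiset.forall_mem_cons.2 ⟨h₁.1.1, fun G hG => h₁.2 G (.inl hG)⟩)
        (fun G hG => h₂ G (.inl hG)) (fun G hG => hΔ G (.inl hG))
      obtain ⟨J, hJ⟩ := ih' (Γ₁ := B ::ₘ d) (Γ₂ := e) hT (by simp)
        (Multiset.forall_mem_cons.2 ⟨h₁.1.2, fun G hG => h₁.2 G (.inr hG)⟩)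
        (fun G hG => h₂ G (.inr hG)) (fun G hG => hΔ G (.inr hG))
      refine ⟨.or I J, ⟨hI.adm, hJ.adm⟩, ?_, .orLeft hI.right hJ.right⟩
      -- The rule leaves two copies of `I ∨ J` in the succedent, which are contracted.
      exact Provable.squash (k := 1) (.orLeft (k := 1) (l := 1) (.orRight₁ hI.left)
        (.orRight₂ hJ.left))
    · simp only [Multiset.forall_mem_cons, Multiset.mem_add] at h₁ h₂
      obtain ⟨I, hI⟩ := ih (Γ₁ := a) (Γ₂ := A ::ₘ b) hT (by simp)
        (fun G hG => h₁ G (.inl hG))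
        (Multiset.forall_mem_cons.2 ⟨h₂.1.1, fun G hG => h₂.2 G (.inl hG)⟩)
        (fun G hG => hΔ G (.inl hG))
      obtain ⟨J, hJ⟩ := ih' (Γ₁ := d) (Γ₂ := B ::ₘ e) hT (by simp)
        (fun G hG => h₁ G (.inr hG))
        (Multiset.forall_mem_cons.2 ⟨h₂.1.2, fun G hG => h₂.2 G (.inr hG)⟩)
        (fun G hG => hΔ G (.inr hG))
      refine ⟨.and I J, ⟨hI.adm, hJ.adm⟩, .andRight hI.left hJ.left, ?_⟩
      have hI' := Provable.andLeft₁ (B := J) hI.right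
      have hJ' := Provable.andLeft₂ (B := I) hJ.right
      rw [Multiset.cons_swap] at hI' hJ'
      have h := Provable.orLeft hI' hJ'
      rw [Multiset.cons_add, Multiset.add_cons, Multiset.cons_swap,
        Multiset.cons_swap (Formula.or A B)] at h
      exact h.contrLeft
  | orRight₁ _ ih =>
    rw [forall_mem_singleton] at hΔ
    obtain ⟨I, hI⟩ := ih hT hΓ h₁ h₂ (forall_mem_singleton.2 hΔ.1)
    exact ⟨I, hI.adm, hI.left, .orRight₁ hI.right⟩
  | orRight₂ _ ih =>
    rw [forall_mem_singleton] at hΔ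
    obtain ⟨I, hI⟩ := ih hT hΓ h₁ h₂ (forall_mem_singleton.2 hΔ.2)
    exact ⟨I, hI.adm, hI.left, .orRight₂ hI.right⟩
  | @allRight Γ A a ha haA _ ih =>
    subst hΓ
    rw [forall_mem_singleton] at hΔ
    have hA := forall_mem_singleton (p := fun G : Formula L 0 => G.Adm P₂ F₂) |>.2
      (Formula.Adm.inst (A := A) hΔ (.var a))
    simp only [Multiset.mem_add] at ha
    obtain ⟨I, hI⟩ := ih hT rfl h₁ h₂ hA
    -- `I` may contain the eigenvariable, which would block the rule.
    obtain ⟨J, hJ, haJ⟩ := hI.exists_notMem_freeVars h₁ h₂ hA (a := a)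
      (.inl ⟨fun G hG => ha G (.inl hG), fun G hG r hr har => by
        rcases Multiset.mem_add.1 hG with hG | hG
        · exact (ha G (.inr hG) (Formula.mem_freeVars_of_mem_atoms (h₂ G hG) hr har)).elim
        · rw [Multiset.mem_singleton.1 hG] at hr
          exact eq_var_of_mem_atoms_inst hΔ haA hr har⟩)
    exact ⟨J, hJ.adm, hJ.left, .allRight a
      (Multiset.forall_mem_cons.2 ⟨haJ, fun G hG => ha G (.inr hG)⟩) haA hJ.right⟩
  | @allLeft Γ A C k t _ ih =>
    rcases cons_eq_add hΓ with ⟨Γ₁, rfl, rfl⟩ | ⟨Γ₂, rfl, rfl⟩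
    · rw [Multiset.forall_mem_cons] at h₁
      obtain ⟨I, hI⟩ := ih (Γ₁ := A.inst t ::ₘ Γ₁) hT (by simp)
        (Multiset.forall_mem_cons.2 ⟨Formula.Adm.inst h₁.1 t, h₁.2⟩) h₂ hΔ
      exact ⟨I, hI.adm, .allLeft (k := 1) t hI.left, hI.right⟩
    · rw [Multiset.forall_mem_cons] at h₂
      obtain ⟨I, hI⟩ := ih (Γ₂ := A.inst t ::ₘ Γ₂) hT (by simp) h₁
        (Multiset.forall_mem_cons.2 ⟨Formula.Adm.inst h₂.1 t, h₂.2⟩) hΔ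
      refine ⟨I, hI.adm, hI.left, ?_⟩
      rw [Multiset.cons_swap]
      exact .allLeft t (by rw [Multiset.cons_swap]; exact hI.right)
  | @exRight Γ A t _ ih =>
    rw [forall_mem_singleton] at hΔ
    obtain ⟨I, hI⟩ := ih hT hΓ h₁ h₂
      (forall_mem_singleton.2 (Formula.Adm.inst (A := A) hΔ t))
    exact ⟨I, hI.adm, hI.left, .exRight t hI.right⟩
  | @exLeft Γ A C k a ha haA haC _ ih =>
    have haΔ : ∀ G ∈ Multiset.replicate k C, a ∉ G.freeVars := fun G hG => by
      rwa [Multiset.eq_of_mem_replicate hG]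
    rcases cons_eq_add hΓ with ⟨Γ₁, rfl, rfl⟩ | ⟨Γ₂, rfl, rfl⟩ <;>
    simp only [Multiset.mem_add] at ha
    · rw [Multiset.forall_mem_cons] at h₁
      have h₁' : ∀ G ∈ A.inst (.var a) ::ₘ Γ₁, G.Adm P₁ F₁ :=
        Multiset.forall_mem_cons.2 ⟨Formula.Adm.inst h₁.1 _, h₁.2⟩
      obtain ⟨I, hI⟩ := ih (Γ₁ := A.inst (.var a) ::ₘ Γ₁) hT (by simp) h₁' h₂ hΔ
      obtain ⟨J, hJ, haJ⟩ := hI.exists_notMem_freeVars h₁' h₂ hΔ (a := a)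
        (.inr ⟨fun G hG => (Multiset.mem_add.1 hG).elim (fun h => ha G (.inr h)) (haΔ G),
          fun G hG r hr har => by
            rcases Multiset.mem_cons.1 hG with rfl | hG
            · exact eq_var_of_mem_atoms_inst h₁.1 haA hr har
            · exact (ha G (.inl hG)
                (Formula.mem_freeVars_of_mem_atoms (h₁.2 G hG) hr har)).elim⟩)
      exact ⟨J, hJ.adm, .exLeft (k := 1) a (fun G hG => ha G (.inl hG)) haA haJ hJ.left,
        hJ.right⟩
    · rw [Multiset.forall_mem_cons] at h₂
      have h₂' : ∀ G ∈ A.inst (.var a) ::ₘ Γ₂, G.Adm P₂ F₂ :=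
        Multiset.forall_mem_cons.2 ⟨Formula.Adm.inst h₂.1 _, h₂.2⟩
      obtain ⟨I, hI⟩ := ih (Γ₂ := A.inst (.var a) ::ₘ Γ₂) hT (by simp) h₁ h₂' hΔ
      obtain ⟨J, hJ, haJ⟩ := hI.exists_notMem_freeVars h₁ h₂' hΔ (a := a)
        (.inl ⟨fun G hG => ha G (.inl hG), fun G hG r hr har => by
          rw [Multiset.cons_add] at hG
          rcases Multiset.mem_cons.1 hG with rfl | hG
          · exact eq_var_of_mem_atoms_inst h₂.1 haA hr har
          · rcases Multiset.mem_add.1 hG with hG | hG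
            · exact (ha G (.inr hG)
                (Formula.mem_freeVars_of_mem_atoms (h₂.2 G hG) hr har)).elim
            · exact (haΔ G hG (Formula.mem_freeVars_of_mem_atoms (hΔ G hG) hr har)).elim⟩)
      refine ⟨J, hJ.adm, hJ.left, ?_⟩
      rw [Multiset.cons_swap]
      refine .exLeft a (Multiset.forall_mem_cons.2 ⟨haJ, fun G hG => ha G (.inr hG)⟩) haA haC ?_
      rw [Multiset.cons_swap]
      exact hJ.right
  | @contrRight Γ C s hs _ ih =>
    obtain ⟨I, hI⟩ := ih hT hΓ h₁ h₂ fun G hG => hΔ G (by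
      rw [Multiset.eq_of_mem_replicate hG]
      exact Multiset.mem_replicate.2 ⟨by omega, rfl⟩)
    exact ⟨I, hI.adm, hI.left, .contrRight hs hI.right⟩
  | @contrLeft Γ A C k _ ih =>
    rcases cons_eq_add hΓ with ⟨Γ₁, rfl, rfl⟩ | ⟨Γ₂, rfl, rfl⟩
    · obtain ⟨I, hI⟩ := ih (Γ₁ := A ::ₘ A ::ₘ Γ₁) hT (by simp)
        (Multiset.forall_mem_cons.2 ⟨h₁ A (Multiset.mem_cons_self _ _), h₁⟩) h₂ hΔ
      exact ⟨I, hI.adm, .contrLeft (k := 1) hI.left, hI.right⟩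
    · obtain ⟨I, hI⟩ := ih (Γ₂ := A ::ₘ A ::ₘ Γ₂) hT (by simp) h₁
        (Multiset.forall_mem_cons.2 ⟨h₂ A (Multiset.mem_cons_self _ _), h₂⟩) hΔ
      refine ⟨I, hI.adm, hI.left, ?_⟩
      have h := hI.right
      rw [Multiset.cons_swap, Multiset.cons_swap I A] at h
      rw [Multiset.cons_swap]
      exact h.contrLeft

/-- Every atom other than a common free variable is removed. Relative to its own function symbols a
formula has only variables as atoms, so a compound atom is missing from a side that lacks its head
symbol. -/
theorem Provable.exists_interpolant {c : Bool} {A B : Formula L 0} (h : Provable c {A} {B})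
    {P₁ P₂ : Set (PredSymbol L)} (hA : A.preds ⊆ P₁) (hB : B.preds ⊆ P₂) {T : Formula L 0}
    (hTP : T.preds ⊆ P₁ ∩ P₂) (hTF : T.funcs = ∅) (hT : ∀ Θ, Provable c Θ {T}) :
    ∃ I : Formula L 0, I.preds ⊆ P₁ ∩ P₂ ∧ I.funcs ⊆ A.funcs ∩ B.funcs ∧
      I.freeVars ⊆ A.freeVars ∩ B.freeVars ∧ Provable c {A} {I} ∧ Provable c {I} {B} := by
  have hA' : ∀ G ∈ ({A} : Multiset (Formula L 0)), G.Adm P₁ A.funcs :=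
    forall_mem_singleton.2 (Formula.adm_of_subset hA subset_rfl)
  have hB' : ∀ G ∈ ({B} : Multiset (Formula L 0)), G.Adm P₂ B.funcs :=
    forall_mem_singleton.2 (Formula.adm_of_subset hB subset_rfl)
  have h0 : ∀ G ∈ (0 : Multiset (Formula L 0)), G.Adm P₂ B.funcs := by simp
  obtain ⟨I, hI⟩ := h.exists_isInterpolant (Γ₁ := {A}) (Γ₂ := 0) (F₁ := A.funcs) (F₂ := B.funcs)
    (Formula.adm_of_subset hTP (hTF ▸ Set.empty_subset _)) hT (add_zero _).symm hA' h0 hB'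
  have hcrit : ∀ r, IsAtom (A.funcs ∩ B.funcs) r →
      (¬ ∃ x ∈ A.freeVars ∩ B.freeVars, r = .var x) →
      (IsAtom A.funcs r ∧ ∀ G ∈ ({A} : Multiset (Formula L 0)), r ∉ G.atoms A.funcs) ∨
      (IsAtom B.funcs r ∧ (∀ G ∈ (0 : Multiset (Formula L 0)), r ∉ G.atoms B.funcs) ∧
        ∀ G ∈ ({B} : Multiset (Formula L 0)), r ∉ G.atoms B.funcs) := by
    intro r hr hrV
    simp only [forall_mem_singleton, Multiset.notMem_zero, false_imp_iff,
      implies_true, true_and] at hA' hB' ⊢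
    cases r with
    | var x =>
      by_cases hx : x ∈ A.freeVars
      · refine .inr ⟨trivial, fun h => hrV ⟨x, ⟨hx, ?_⟩, rfl⟩⟩
        exact Formula.mem_freeVars_of_mem_atoms hB' h (by simp)
      · exact .inl ⟨trivial, fun h => hx (Formula.mem_freeVars_of_mem_atoms hA' h (by simp))⟩
    | func f ts =>
      refine (not_and_or.1 hr).imp (fun hf => ⟨hf, fun h => ?_⟩) fun hf => ⟨hf, fun h => ?_⟩
      · obtain ⟨x, hx⟩ := Formula.atoms_eq_var_of_funcs_subset subset_rfl h
        cases hx
      · obtain ⟨x, hx⟩ := Formula.atoms_eq_var_of_funcs_subset subset_rfl h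
        cases hx
  have hup : ∀ r s : L.Term ℕ, (¬ ∃ x ∈ A.freeVars ∩ B.freeVars, r = .var x) → IsSubterm r s →
      ¬ ∃ x ∈ A.freeVars ∩ B.freeVars, s = .var x := by
    rintro r s hr hrs ⟨x, hx, rfl⟩
    exact hr ⟨x, hx, hrs⟩
  obtain ⟨J, hJ, hat⟩ := hI.exists_remove_all hA' h0 hB' _ hcrit hup
  simp only [not_not] at hat
  refine ⟨J, hJ.adm.preds_subset, Formula.funcs_subset_of_atoms fun r hr => ?_, fun a ha => ?_,
    hJ.left, hJ.right⟩
  · obtain ⟨x, -, hx⟩ := hat r hr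
    exact ⟨x, hx⟩
  · obtain ⟨r, hr, har⟩ := Formula.exists_mem_atoms (F := A.funcs ∩ B.funcs) ha
    obtain ⟨x, hx, rfl⟩ := hat r hr
    obtain rfl : a = x := by simpa using har
    exact hx

/-! ### Sequents whose two parts have no predicate symbol in common -/

/-- Replaces the free variable `a` by `z`. -/
noncomputable def Formula.rename (a z : ℕ) (G : Formula L 0) : Formula L 0 :=
  G.gsub Set.univ (Sum.elim (repl (.var a) (.var (Sum.inl z))) Fin.elim0)

theorem Formula.adm_univ {n : ℕ} (G : Formula L n) : G.Adm Set.univ Set.univ :=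
  Formula.adm_of_subset (Set.subset_univ _) (Set.subset_univ _)

theorem Formula.rename_of_notMem {G : Formula L 0} {a : ℕ} (ha : a ∉ G.freeVars) (z : ℕ) :
    G.rename a z = G :=
  Formula.gsub_repl_of_notMem G.adm_univ
    (fun h => ha (Formula.mem_freeVars_of_mem_atoms G.adm_univ h (by simp))) _

/-- Renaming abstracts `a` and instantiates at `z`. As `z` does not occur in the abstraction,
renaming back instantiates it at `a`. -/
theorem Formula.rename_rename {G : Formula L 0} {a z : ℕ} (hz : z ∉ G.freeVars) :
    (G.rename a z).rename z a = G := by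
  have hJ := G.adm_univ.abstr (.var a)
  have hzJ : (Term.var z : L.Term ℕ) ∉ (G.abstr Set.univ (.var a)).atoms Set.univ := fun h =>
    hz (Formula.mem_freeVars_of_mem_atoms G.adm_univ (Formula.mem_atoms_abstr h).1 (by simp))
  have h := Formula.gsub_repl_of_notMem (G := .all (G.abstr Set.univ (.var a))) hJ hzJ
    (.var (Sum.inl a))
  rw [Formula.gsub] at h
  injection h with _ h
  have e := Formula.abstr_inst (F := Set.univ) G (.var a) (.var z)
  rw [Term.relabel] at e
  rw [Formula.rename, Formula.rename, ← e, Formula.gsub_inst hJ, h, Term.relabel, tsub,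
    Sum.elim_inl, repl_self]
  exact Formula.abstr_inst_self G.adm_univ (.var a)

theorem Formula.notMem_freeVars_rename (G : Formula L 0) {a z : ℕ} (hz : z ≠ a) :
    a ∉ (G.rename a z).freeVars := by
  intro ha
  obtain ⟨r, hr, har⟩ := Formula.exists_mem_atoms (F := Set.univ) ha
  rcases Formula.mem_atoms_gsub hr with ⟨s, hs, h⟩ | ⟨i, -⟩
  · by_cases e : s = .var a
    · rw [e, Sum.elim_inl, repl_self] at h
      obtain rfl : r = .var z := h
      exact hz (Finset.mem_singleton.1 har).symm
    · rw [Sum.elim_inl, repl_of_ne e, termAtoms_relabel_inl (Formula.isAtom_of_mem_atoms hs)] at h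
      obtain rfl : r = s := h
      have hat := Formula.isAtom_of_mem_atoms hs
      cases r with
      | var x => exact e (congrArg _ (Finset.mem_singleton.1 har).symm)
      | func f ts => exact hat (Set.mem_univ _)
  · exact i.elim0

theorem Provable.rename {c : Bool} {Γ Δ : Multiset (Formula L 0)} (h : Provable c Γ Δ)
    (a z : ℕ) : Provable c (Γ.map (Formula.rename a z)) (Δ.map (Formula.rename a z)) := by
  have h' := h.gsub (fun G _ => G.adm_univ) (fun G _ => G.adm_univ)
    (Sum.elim (repl (.var a) (.var (Sum.inl z))) Fin.elim0) 0
  rwa [add_zero] at h'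

/-- A refutable `Θ` may contain the eigenvariable of the next rule. Renaming it to a `z` fresh for
`Θ` and `Ξ` avoids the clash and can be undone after the rule. -/
theorem Provable.exists_rename {c : Bool} {Θ : Multiset (Formula L 0)} (hΘ : Provable c Θ 0)
    (a : ℕ) (Ξ : Multiset (Formula L 0)) :
    ∃ Θ', Provable c Θ' 0 ∧ (∀ G ∈ Θ', a ∉ G.freeVars) ∧
      ∀ Γ Δ, (∀ G ∈ Γ, G ∈ Ξ) → (∀ G ∈ Δ, G ∈ Ξ) → Provable c (Θ' + Γ) Δ →
        Provable c (Θ + Γ) Δ := by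
  by_cases ha : ∀ G ∈ Θ, a ∉ G.freeVars
  · exact ⟨Θ, hΘ, ha, fun _ _ _ _ h => h⟩
  · obtain ⟨z, hz⟩ := exists_fresh (Θ + Ξ)
    simp only [Multiset.mem_add] at hz
    have hza : z ≠ a := by
      rintro rfl
      exact ha fun G hG => hz G (.inl hG)
    refine ⟨_, hΘ.rename a z, ?_, fun Γ Δ hΓ hΔ h => ?_⟩
    · intro G hG
      obtain ⟨G', -, rfl⟩ := Multiset.mem_map.1 hG
      exact G'.notMem_freeVars_rename hza
    · have h' := h.rename z a
      have hid : ∀ Γ : Multiset (Formula L 0), (∀ G ∈ Γ, G ∈ Ξ) →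
          Γ.map (Formula.rename z a) = Γ := fun Γ hΓ =>
        (Multiset.map_congr rfl fun G hG =>
          Formula.rename_of_notMem (hz G (.inr (hΓ G hG))) a).trans (Multiset.map_id' Γ)
      have hback : (Θ.map (Formula.rename a z)).map (Formula.rename z a) = Θ :=
        (Multiset.map_map _ _ _).trans ((Multiset.map_congr rfl fun G hG =>
          Formula.rename_rename (hz G (.inl hG))).trans (Multiset.map_id' Θ))
      rwa [Multiset.map_add, hid Γ hΓ, hid Δ hΔ, hback] at h'

/-- Provability of `Γ → Δ` up to the multiplicity of the succedent formula. -/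
def Concl (c : Bool) (Γ Δ : Multiset (Formula L 0)) : Prop :=
  (Δ = 0 ∧ Provable c Γ 0) ∨ ∃ C ∈ Δ, Provable c Γ {C}

section

variable {c : Bool} {Γ Γ' Δ Δ' Θ : Multiset (Formula L 0)}

theorem concl_zero : Concl c Γ 0 ↔ Provable c Γ 0 := by simp [Concl]

theorem concl_singleton {C : Formula L 0} : Concl c Γ {C} ↔ Provable c Γ {C} := by simp [Concl]

theorem Concl.map (h : Concl c Γ Δ) (h₀ : Provable c Γ 0 → Provable c Γ' 0)
    (h₁ : ∀ C ∈ Δ, Provable c Γ {C} → Provable c Γ' {C}) : Concl c Γ' Δ :=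
  h.imp (And.imp_right h₀) fun ⟨C, hC, h⟩ => ⟨C, hC, h₁ C hC h⟩

theorem Concl.mono_left (h : Concl c Γ Δ) (hΓ : Γ ≤ Γ') : Concl c Γ' Δ :=
  h.map (fun h => h.mono hΓ) fun _ _ h => h.mono hΓ

theorem Concl.mono_right (h : Concl c Γ Δ) (hΔ : Δ ≠ 0) (hΔ' : Δ ⊆ Δ') : Concl c Γ Δ' :=
  .inr ((h.resolve_left fun h => hΔ h.1).imp fun _ h => ⟨hΔ' h.1, h.2⟩)

theorem Concl.contract_add (h : Concl c (Θ + (Θ + Γ)) Δ) : Concl c (Θ + Γ) Δ :=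
  h.map (fun h => h.contract_add (C := .top) (k := 0)) fun C _ h => h.contract_add (C := C) (k := 1)

theorem Concl.or {A B C : Formula L 0} {k l : ℕ} (h : Concl c (A ::ₘ Γ) (Multiset.replicate k C))
    (h' : Concl c (B ::ₘ Γ') (Multiset.replicate l C)) :
    Concl c (.or A B ::ₘ (Γ + Γ')) (Multiset.replicate (k + l) C) := by
  rw [Multiset.replicate_add]
  rcases h with ⟨hk, h⟩ | ⟨D, hD, h⟩ <;> rcases h' with ⟨hl, h'⟩ | ⟨D', hD', h'⟩
  · exact .inl ⟨by rw [hk, hl, add_zero], .orLeft (C := C) (k := 0) (l := 0) h h'⟩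
  · exact .inr ⟨D', Multiset.mem_add.2 (.inr hD'), .orLeft (C := D') (k := 0) (l := 1) h h'⟩
  · exact .inr ⟨D, Multiset.mem_add.2 (.inl hD), .orLeft (C := D) (k := 1) (l := 0) h h'⟩
  · refine .inr ⟨D, Multiset.mem_add.2 (.inl hD), ?_⟩
    rw [Multiset.eq_of_mem_replicate hD] at h ⊢
    rw [Multiset.eq_of_mem_replicate hD'] at h'
    exact Provable.squash (k := 1) (.orLeft (k := 1) (l := 1) h h')

/-- Either `Γ₁` is refutable and every refutable antecedent completes `Γ₂ → Δ`, or `Γ₂ → Δ` is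
provable. -/
def Separates (c : Bool) (Γ₁ Γ₂ Δ : Multiset (Formula L 0)) : Prop :=
  (Provable c Γ₁ 0 ∧ ∀ Θ, Provable c Θ 0 → Concl c (Θ + Γ₂) Δ) ∨ Concl c Γ₂ Δ

variable {Γ₁ Γ₁' Γ₂ Γ₂' : Multiset (Formula L 0)}

theorem Separates.map_left (h : Separates c Γ₁ Γ₂ Δ) (h' : Provable c Γ₁ 0 → Provable c Γ₁' 0) :
    Separates c Γ₁' Γ₂ Δ :=
  h.imp_left (And.imp_left h')

theorem Separates.map_right (h : Separates c Γ₁ Γ₂ Δ)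
    (h' : ∀ Θ, Concl c (Θ + Γ₂) Δ → Concl c (Θ + Γ₂') Δ') : Separates c Γ₁ Γ₂' Δ' := by
  refine h.imp (And.imp_right fun h Θ hΘ => h' Θ (h Θ hΘ)) fun h => ?_
  rw [← zero_add Γ₂] at h
  simpa using h' 0 h

theorem Separates.map_right_of_notMem (a : ℕ) (h : Separates c Γ₁ Γ₂ Δ)
    (h' : ∀ Θ, (∀ G ∈ Θ, a ∉ G.freeVars) → Concl c (Θ + Γ₂) Δ → Concl c (Θ + Γ₂') Δ') :
    Separates c Γ₁ Γ₂' Δ' := by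
  refine h.imp (And.imp_right fun h Θ hΘ => ?_) fun h => ?_
  · obtain ⟨Θ', hΘ', ha, hback⟩ := hΘ.exists_rename a (Γ₂' + Δ')
    simp only [Multiset.mem_add] at hback
    refine (h' Θ' ha (h Θ' hΘ')).map (fun h => ?_) fun C hC h => ?_
    · exact hback _ _ (fun _ => .inl) (by simp) h
    · exact hback _ _ (fun _ => .inl) (by simp [hC]) h
  · rw [← zero_add Γ₂] at h
    simpa using h' 0 (by simp) h

theorem Separates.concl_add (h : Separates c Γ₁ Γ₂ Δ) (hΘ : Provable c Θ 0) :
    Concl c (Θ + Γ₂) Δ :=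
  h.elim (fun h => h.2 Θ hΘ) fun h => h.mono_left (Multiset.le_add_left _ _)

theorem Separates.or_left {A B C : Formula L 0} {k l : ℕ}
    (h : Separates c (A ::ₘ Γ₁) Γ₂ (Multiset.replicate k C))
    (h' : Separates c (B ::ₘ Γ₁') Γ₂' (Multiset.replicate l C)) :
    Separates c (.or A B ::ₘ (Γ₁ + Γ₁')) (Γ₂ + Γ₂') (Multiset.replicate (k + l) C) := by
  rw [Multiset.replicate_add]
  have hsub := Multiset.subset_of_le (Multiset.le_add_right (Multiset.replicate k C)
    (Multiset.replicate l C))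
  have hsub' := Multiset.subset_of_le (Multiset.le_add_left (Multiset.replicate l C)
    (Multiset.replicate k C))
  rcases h with ⟨h₁, h₂⟩ | h₂
  · rcases h' with ⟨h₁', h₂'⟩ | h₂'
    · refine .inl ⟨.orLeft (C := C) (k := 0) (l := 0) h₁ h₁', fun Θ hΘ => ?_⟩
      -- For `k = 0` the first premise yields only an empty succedent, which cannot be weakened to
      -- copies of `C`; the second one is used instead.
      by_cases hk : Multiset.replicate k C = 0
      · rw [hk, zero_add, add_left_comm]
        exact (h₂' Θ hΘ).mono_left (Multiset.le_add_left _ _)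
      · rw [← add_assoc]
        exact ((h₂ Θ hΘ).mono_left (Multiset.le_add_right _ _)).mono_right hk hsub
    · refine .inr ?_
      -- For `l = 0` the antecedent `Γ₂'` is itself refutable and plays the part of `Θ` for the
      -- first premise.
      by_cases hl : Multiset.replicate l C = 0
      · rw [hl, concl_zero] at h₂'
        rw [hl, add_zero, add_comm]
        exact h₂ _ h₂'
      · exact (h₂'.mono_left (Multiset.le_add_left _ _)).mono_right hl hsub'
  · refine .inr ?_
    by_cases hk : Multiset.replicate k C = 0
    · rw [hk, concl_zero] at h₂
      rw [hk, zero_add]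
      exact h'.concl_add h₂
    · exact (h₂.mono_left (Multiset.le_add_right _ _)).mono_right hk hsub

/-- A rule with two premises which acts on the second part. -/
theorem Separates.map₂_right {Δ'' Γ₂'' : Multiset (Formula L 0)} (h : Separates c Γ₁ Γ₂ Δ)
    (h' : Separates c Γ₁' Γ₂' Δ')
    (hr : ∀ Θ Θ', Concl c (Θ + Γ₂) Δ → Concl c (Θ' + Γ₂') Δ' →
      Concl c (Θ + (Θ' + Γ₂'')) Δ'') :
    Separates c (Γ₁ + Γ₁') Γ₂'' Δ'' := by
  -- One refutable half suffices, since the sum is then refutable by weakening; the same `Θ`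
  -- completes both premises and is contracted.
  have hleft : Provable c (Γ₁ + Γ₁') 0 → Separates c (Γ₁ + Γ₁') Γ₂'' Δ'' := fun h₁ =>
    .inl ⟨h₁, fun Θ hΘ => (hr Θ Θ (h.concl_add hΘ) (h'.concl_add hΘ)).contract_add⟩
  rcases id h with ⟨h₁, -⟩ | h₂
  · exact hleft (h₁.mono (Multiset.le_add_right _ _))
  rcases id h' with ⟨h₁, -⟩ | h₂'
  · exact hleft (h₁.mono (Multiset.le_add_left _ _))
  rw [← zero_add Γ₂] at h₂
  rw [← zero_add Γ₂'] at h₂'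
  exact .inr (by simpa using hr 0 0 h₂ h₂')

end

/-- An axiom cannot connect the two sides, because every formula contains a predicate symbol; it is
this that replaces the interpolant `C`. -/
theorem Provable.separates {c : Bool} {Γ Δ : Multiset (Formula L 0)} (h : Provable c Γ Δ)
    {P₁ P₂ : Set (PredSymbol L)} (hP : Disjoint P₁ P₂) {Γ₁ Γ₂ : Multiset (Formula L 0)}
    (hΓ : Γ = Γ₁ + Γ₂) (h₁ : ∀ G ∈ Γ₁, G.preds ⊆ P₁) (h₂ : ∀ G ∈ Γ₂, G.preds ⊆ P₂)
    (hΔ : ∀ G ∈ Δ, G.preds ⊆ P₂) : Separates c Γ₁ Γ₂ Δ := by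
  induction h generalizing P₁ P₂ Γ₁ Γ₂ with
  | ax Γ C =>
    rw [forall_mem_singleton] at hΔ
    rcases cons_eq_add hΓ with ⟨Γ₁, rfl, rfl⟩ | ⟨Γ₂, rfl, rfl⟩
    · rw [Multiset.forall_mem_cons] at h₁
      obtain ⟨p, hp⟩ := C.preds_nonempty
      exact (Set.disjoint_left.1 hP (h₁.1 hp) (hΔ hp)).elim
    · exact .inr (concl_singleton.2 (.ax _ _))
  | topAx hc Γ => exact .inr (concl_singleton.2 (.topAx hc _))
  | botAx hc Γ =>
    rcases cons_eq_add hΓ with ⟨Γ₁, rfl, rfl⟩ | ⟨Γ₂, rfl, rfl⟩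
    · exact .inl ⟨.botAx hc _, fun Θ hΘ => concl_zero.2 (hΘ.add_right _)⟩
    · exact .inr (concl_zero.2 (.botAx hc _))
  | @negLeft Γ A _ ih =>
    rcases cons_eq_add hΓ with ⟨Γ₁, rfl, rfl⟩ | ⟨Γ₂, rfl, rfl⟩
    · rw [Multiset.forall_mem_cons] at h₁
      -- With the sides exchanged, the alternatives are that `Γ₂` is refutable or that `Γ₁ → A` is
      -- provable; the latter makes `¬A, Γ₁` refutable.
      rcases ih hP.symm (add_comm _ _) h₂ h₁.2 (forall_mem_singleton.2 h₁.1) with ⟨h, -⟩ | h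
      · exact .inr (concl_zero.2 h)
      · exact .inl ⟨.negLeft (concl_singleton.1 h), fun Θ hΘ => concl_zero.2 (hΘ.add_right _)⟩
    · rw [Multiset.forall_mem_cons] at h₂
      refine (ih hP rfl h₁ h₂.2 (forall_mem_singleton.2 h₂.1)).map_right fun Θ h => ?_
      rw [concl_singleton] at h
      rw [Multiset.add_cons]
      exact concl_zero.2 h.negLeft
  | @negRight Γ A _ ih =>
    rw [forall_mem_singleton] at hΔ
    refine (ih (Γ₂ := A ::ₘ Γ₂) hP (by rw [hΓ, Multiset.add_cons]) h₁
      (Multiset.forall_mem_cons.2 ⟨hΔ, h₂⟩) (by simp)).map_right fun Θ h => ?_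
    rw [concl_zero, Multiset.add_cons] at h
    exact concl_singleton.2 h.negRight
  | andRight _ _ ih ih' =>
    rw [forall_mem_singleton] at hΔ
    obtain ⟨a, b, d, e, rfl, rfl, rfl, rfl⟩ := add_eq_add_refine hΓ
    simp only [Multiset.mem_add] at h₁ h₂
    refine Separates.map₂_right
      (ih hP rfl (fun G hG => h₁ G (.inl hG)) (fun G hG => h₂ G (.inl hG))
        (forall_mem_singleton.2 (Set.union_subset_iff.1 hΔ).1))
      (ih' hP rfl (fun G hG => h₁ G (.inr hG)) (fun G hG => h₂ G (.inr hG))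
        (forall_mem_singleton.2 (Set.union_subset_iff.1 hΔ).2)) fun Θ Θ' h h' => ?_
    rw [concl_singleton] at h h' ⊢
    have := Provable.andRight h h'
    rwa [add_assoc, add_left_comm b] at this
  | @andLeft₁ Γ A B C k _ ih =>
    rcases cons_eq_add hΓ with ⟨Γ₁, rfl, rfl⟩ | ⟨Γ₂, rfl, rfl⟩
    · rw [Multiset.forall_mem_cons] at h₁
      exact (ih (Γ₁ := A ::ₘ Γ₁) hP (by simp)
        (Multiset.forall_mem_cons.2 ⟨(Set.union_subset_iff.1 h₁.1).1, h₁.2⟩) h₂ hΔ).map_left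
        fun h => .andLeft₁ (C := C) (k := 0) h
    · rw [Multiset.forall_mem_cons] at h₂
      refine (ih (Γ₂ := A ::ₘ Γ₂) hP (by simp) h₁
        (Multiset.forall_mem_cons.2 ⟨(Set.union_subset_iff.1 h₂.1).1, h₂.2⟩) hΔ).map_right
        fun Θ h => ?_
      rw [Multiset.add_cons] at h ⊢
      exact h.map (fun h => .andLeft₁ (C := C) (k := 0) h) fun D _ h => .andLeft₁ (k := 1) h
  | @andLeft₂ Γ A B C k _ ih =>
    rcases cons_eq_add hΓ with ⟨Γ₁, rfl, rfl⟩ | ⟨Γ₂, rfl, rfl⟩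
    · rw [Multiset.forall_mem_cons] at h₁
      exact (ih (Γ₁ := A ::ₘ Γ₁) hP (by simp)
        (Multiset.forall_mem_cons.2 ⟨(Set.union_subset_iff.1 h₁.1).2, h₁.2⟩) h₂ hΔ).map_left
        fun h => .andLeft₂ (C := C) (k := 0) h
    · rw [Multiset.forall_mem_cons] at h₂
      refine (ih (Γ₂ := A ::ₘ Γ₂) hP (by simp) h₁
        (Multiset.forall_mem_cons.2 ⟨(Set.union_subset_iff.1 h₂.1).2, h₂.2⟩) hΔ).map_right
        fun Θ h => ?_
      rw [Multiset.add_cons] at h ⊢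
      exact h.map (fun h => .andLeft₂ (C := C) (k := 0) h) fun D _ h => .andLeft₂ (k := 1) h
  | @orLeft Γ Γ' A B C k l _ _ ih ih' =>
    simp only [Multiset.replicate_add, Multiset.mem_add] at hΔ
    rcases cons_eq_add hΓ with ⟨Γ₁, rfl, he⟩ | ⟨Γ₂, rfl, he⟩ <;>
    obtain ⟨a, b, d, e, rfl, rfl, rfl, rfl⟩ := add_eq_add_refine he
    · simp only [Multiset.forall_mem_cons, Multiset.mem_add] at h₁ h₂
      have hu := Set.union_subset_iff.1 h₁.1
      exact Separates.or_left
        (ih (Γ₁ := A ::ₘ a) (Γ₂ := b) hP (by simp)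
          (Multiset.forall_mem_cons.2 ⟨hu.1, fun G hG => h₁.2 G (.inl hG)⟩)
          (fun G hG => h₂ G (.inl hG)) (fun G hG => hΔ G (.inl hG)))
        (ih' (Γ₁ := B ::ₘ d) (Γ₂ := e) hP (by simp)
          (Multiset.forall_mem_cons.2 ⟨hu.2, fun G hG => h₁.2 G (.inr hG)⟩)
          (fun G hG => h₂ G (.inr hG)) (fun G hG => hΔ G (.inr hG)))
    · simp only [Multiset.forall_mem_cons, Multiset.mem_add] at h₁ h₂
      have hu := Set.union_subset_iff.1 h₂.1
      refine Separates.map₂_right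
        (ih (Γ₁ := a) (Γ₂ := A ::ₘ b) hP (by simp) (fun G hG => h₁ G (.inl hG))
          (Multiset.forall_mem_cons.2 ⟨hu.1, fun G hG => h₂.2 G (.inl hG)⟩)
          (fun G hG => hΔ G (.inl hG)))
        (ih' (Γ₁ := d) (Γ₂ := B ::ₘ e) hP (by simp) (fun G hG => h₁ G (.inr hG))
          (Multiset.forall_mem_cons.2 ⟨hu.2, fun G hG => h₂.2 G (.inr hG)⟩)
          (fun G hG => hΔ G (.inr hG))) fun Θ Θ' h h' => ?_
      rw [Multiset.add_cons] at h h'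
      have := h.or h'
      rwa [add_assoc, add_left_comm b, ← Multiset.add_cons, ← Multiset.add_cons] at this
  | orRight₁ _ ih =>
    rw [forall_mem_singleton] at hΔ
    refine (ih hP hΓ h₁ h₂
      (forall_mem_singleton.2 (Set.union_subset_iff.1 hΔ).1)).map_right fun Θ h => ?_
    exact concl_singleton.2 (.orRight₁ (concl_singleton.1 h))
  | orRight₂ _ ih =>
    rw [forall_mem_singleton] at hΔ
    refine (ih hP hΓ h₁ h₂
      (forall_mem_singleton.2 (Set.union_subset_iff.1 hΔ).2)).map_right fun Θ h => ?_
    exact concl_singleton.2 (.orRight₂ (concl_singleton.1 h))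
  | @allRight Γ A a ha haA _ ih =>
    subst hΓ
    rw [forall_mem_singleton] at hΔ
    simp only [Multiset.mem_add] at ha
    refine (ih hP rfl h₁ h₂ (forall_mem_singleton.2
      ((A.preds_inst _).trans_subset hΔ))).map_right_of_notMem a fun Θ hΘ h => ?_
    refine concl_singleton.2 (.allRight a (fun G hG => ?_) haA (concl_singleton.1 h))
    exact (Multiset.mem_add.1 hG).elim (hΘ G) fun h => ha G (.inr h)
  | @allLeft Γ A C k t _ ih =>
    rcases cons_eq_add hΓ with ⟨Γ₁, rfl, rfl⟩ | ⟨Γ₂, rfl, rfl⟩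
    · rw [Multiset.forall_mem_cons] at h₁
      exact (ih (Γ₁ := A.inst t ::ₘ Γ₁) hP (by simp)
        (Multiset.forall_mem_cons.2 ⟨(A.preds_inst t).trans_subset h₁.1, h₁.2⟩) h₂ hΔ).map_left
        fun h => .allLeft (C := C) (k := 0) t h
    · rw [Multiset.forall_mem_cons] at h₂
      refine (ih (Γ₂ := A.inst t ::ₘ Γ₂) hP (by simp) h₁
        (Multiset.forall_mem_cons.2 ⟨(A.preds_inst t).trans_subset h₂.1, h₂.2⟩) hΔ).map_right
        fun Θ h => ?_
      rw [Multiset.add_cons] at h ⊢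
      exact h.map (fun h => .allLeft (C := C) (k := 0) t h) fun D _ h => .allLeft (k := 1) t h
  | @exRight Γ A t _ ih =>
    rw [forall_mem_singleton] at hΔ
    refine (ih hP hΓ h₁ h₂ (forall_mem_singleton.2
      ((A.preds_inst t).trans_subset hΔ))).map_right fun Θ h => ?_
    exact concl_singleton.2 (.exRight t (concl_singleton.1 h))
  | @exLeft Γ A C k a ha haA haC _ ih =>
    rcases cons_eq_add hΓ with ⟨Γ₁, rfl, rfl⟩ | ⟨Γ₂, rfl, rfl⟩ <;>
    simp only [Multiset.mem_add] at ha
    · rw [Multiset.forall_mem_cons] at h₁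
      exact (ih (Γ₁ := A.inst (.var a) ::ₘ Γ₁) hP (by simp)
        (Multiset.forall_mem_cons.2 ⟨(A.preds_inst _).trans_subset h₁.1, h₁.2⟩) h₂ hΔ).map_left
        fun h => .exLeft (C := C) (k := 0) a (fun G hG => ha G (.inl hG)) haA haC h
    · rw [Multiset.forall_mem_cons] at h₂
      refine (ih (Γ₂ := A.inst (.var a) ::ₘ Γ₂) hP (by simp) h₁
        (Multiset.forall_mem_cons.2 ⟨(A.preds_inst _).trans_subset h₂.1, h₂.2⟩)
        hΔ).map_right_of_notMem a fun Θ hΘ h => ?_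
      have ha' : ∀ G ∈ Θ + Γ₂, a ∉ G.freeVars := fun G hG =>
        (Multiset.mem_add.1 hG).elim (hΘ G) fun h => ha G (.inr h)
      rw [Multiset.add_cons] at h ⊢
      refine h.map (fun h => .exLeft (C := C) (k := 0) a ha' haA haC h) fun D hD h => ?_
      rw [Multiset.eq_of_mem_replicate hD] at h ⊢
      exact .exLeft (k := 1) a ha' haA haC h
  | @contrRight Γ C s hs _ ih =>
    have hsub : Multiset.replicate s C ⊆ Multiset.replicate (s - 1) C := fun G hG => by
      rw [Multiset.eq_of_mem_replicate hG]
      exact Multiset.mem_replicate.2 ⟨by omega, rfl⟩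
    have hne : Multiset.replicate s C ≠ 0 := fun h => by
      have := congrArg Multiset.card h
      simp at this
      omega
    exact (ih hP hΓ h₁ h₂ fun G hG => hΔ G (hsub hG)).map_right fun Θ h => h.mono_right hne hsub
  | @contrLeft Γ A C k _ ih =>
    rcases cons_eq_add hΓ with ⟨Γ₁, rfl, rfl⟩ | ⟨Γ₂, rfl, rfl⟩
    · exact (ih (Γ₁ := A ::ₘ A ::ₘ Γ₁) hP (by simp)
        (Multiset.forall_mem_cons.2 ⟨h₁ A (Multiset.mem_cons_self _ _), h₁⟩) h₂ hΔ).map_left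
        fun h => .contrLeft (C := C) (k := 0) h
    · refine (ih (Γ₂ := A ::ₘ A ::ₘ Γ₂) hP (by simp) h₁
        (Multiset.forall_mem_cons.2 ⟨h₂ A (Multiset.mem_cons_self _ _), h₂⟩) hΔ).map_right
        fun Θ h => ?_
      rw [Multiset.add_cons, Multiset.add_cons] at h
      rw [Multiset.add_cons]
      exact h.map (fun h => .contrLeft (C := C) (k := 0) h) fun D _ h => .contrLeft (k := 1) h

/-! ### Interpolation -/

theorem provable_not_and_not (c : Bool) (R : Formula L 0) (Θ : Multiset (Formula L 0)) :
    Provable c Θ {.neg (.and R (.neg R))} := by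
  refine .negRight (.contrLeft (C := R) (k := 0) (.andLeft₁ (k := 0) ?_))
  rw [Multiset.cons_swap]
  refine .andLeft₂ (C := R) (k := 0) (.negLeft (.ax _ _))

theorem exists_verum (c : Bool) (p : PredSymbol L) :
    ∃ T : Formula L 0, T.preds ⊆ {p} ∧ T.funcs = ∅ ∧ ∀ Θ, Provable c Θ {T} := by
  have h : ∃ R : Formula L 0, R.preds = {p} ∧ R.funcs = ∅ := by
    cases p with
    | top => exact ⟨.top, rfl, rfl⟩
    | bot => exact ⟨.bot, rfl, rfl⟩
    -- The variable `0` need not be common to both formulas; it is removed later with the other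
    -- unwanted atoms.
    | rel R => exact ⟨.rel R fun _ => .var (Sum.inl 0), rfl, by simp [Formula.funcs, termFuncs]⟩
  obtain ⟨R, hR, hR'⟩ := h
  exact ⟨.neg (.and R (.neg R)), by simp [Formula.preds, hR], by simp [Formula.funcs, hR'],
    provable_not_and_not c R⟩

end LJ

theorem mainTheorem5 (L : FirstOrder.Language.{u, v}) (c : Bool) (A B : LJ.Formula L 0)
    (hAB : LJ.Provable c {A} {B}) :
    ((A.preds ∩ B.preds).Nonempty →
      ∃ I : LJ.Formula L 0,
        I.preds ⊆ A.preds ∩ B.preds ∧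
        I.funcs ⊆ A.funcs ∩ B.funcs ∧
        I.freeVars ⊆ A.freeVars ∩ B.freeVars ∧
        LJ.Provable c {A} {I} ∧ LJ.Provable c {I} {B}) ∧
    (A.preds ∩ B.preds = ∅ → LJ.Provable c {A} 0 ∨ LJ.Provable c 0 {B}) ∧
    (c = true →
      ∃ I : LJ.Formula L 0,
        I.preds ⊆ (A.preds ∩ B.preds) ∪ {LJ.PredSymbol.top, LJ.PredSymbol.bot} ∧
        I.funcs ⊆ A.funcs ∩ B.funcs ∧
        I.freeVars ⊆ A.freeVars ∩ B.freeVars ∧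
        LJ.Provable c {A} {I} ∧ LJ.Provable c {I} {B}) := by
  refine ⟨fun ⟨p, hp⟩ => ?_, fun h => ?_, fun hc => ?_⟩
  · obtain ⟨T, hTP, hTF, hT⟩ := LJ.exists_verum c p
    exact hAB.exists_interpolant subset_rfl subset_rfl
      (hTP.trans (Set.singleton_subset_iff.2 hp)) hTF hT
  · have hsep := hAB.separates (Set.disjoint_iff_inter_eq_empty.2 h) (Γ₁ := {A}) (Γ₂ := 0)
      (add_zero _).symm (LJ.forall_mem_singleton.2 subset_rfl) (by simp)
      (LJ.forall_mem_singleton.2 subset_rfl)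
    exact hsep.imp And.left LJ.concl_singleton.1
  -- Both predicate sets are enlarged by `⊤` and `⊥`, so that `⊤` becomes a common symbol.
  · rw [Set.inter_union_distrib_right]
    exact hAB.exists_interpolant (T := .top) Set.subset_union_left Set.subset_union_left
      (by simp [LJ.Formula.preds]) rfl (.topAx hc)
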